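/- Let $\eta,\theta>0$, $\eta\ne\theta$, $0<\gamma\le 1$ and $\beta\ge 0$. For $b,h>0$ let $\mathcal P^{b}([0,h])$ be the set of probability measures on $[0,h]$ that are absolutely continuous with density at most $\frac1{bx}$, and let $\mathcal P^{0}([0,h])=\mathcal P([0,h])$. Put $\ln 0=-\infty$. **Equilibrium measure.** For $\xi\in(-\gamma^2,1)$ let $\kappa=\gamma^2-|\xi|$ if $\xi\le 0$, $\kappa=\gamma^2$ if $0<\xi\le 1-\gamma^2$, and $\kappa=1-\xi$ if $\xi>1-\gamma^2$ and $\xi>0$. The *equilibrium measure* $\mu$ of the Muttalib–Borodin slice at time $\xi$ is the unique minimizer over $\mathcal P^{\beta\kappa}([0,e^{-\beta(\gamma^2-\kappa)}])$ of the rate function $$I^{(\xi)}(\mu)=-\frac{\kappa^2}{2}\iint\bigl(\ln|x^\theta-y^\theta|+\ln|x^\eta-y^\eta|\bigr)\,d\mu(x)\,d\mu(y)-K^{(\xi)}(\mu)-M^{(\xi)}(\mu),$$ where * if $\xi\in(-\gamma^2,0]$: $K^{(\xi)}(\mu)=\kappa\int\int_{\gamma^2-1}^{|\xi|}\ln(1-x^\theta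 e^{\beta\theta u})\,du\,d\mu(x)$ and $M^{(\xi)}(\mu)=\kappa\eta|\xi|\int\ln x\,d\mu(x)$; * if $\xi\in(0,1-\gamma^2]$: $K^{(\xi)}(\mu)=\kappa\int\int_0^{1-\gamma^2-\xi}\ln(1-x^\theta e^{-\beta\theta u})\,du\,d\mu(x)$ and $M^{(\xi)}(\mu)=\kappa\theta\xi\int\ln x\,d\mu(x)$; * if $\xi\in(1-\gamma^2,1)$ and $\xi>0$: $K^{(\xi)}(\mu)=\kappa\int\int_{1-\gamma^2-\xi}^{0}\ln(1-x^\eta e^{-\beta\eta u})\,du\,d\mu(x)$ and $M^{(\xi)}(\mu)=\kappa\theta\xi\int\ln x\,d\mu(x)$. **Model problems.** Given parameters $\nu>1$, $\kappa,\alpha,\rho>0$, $m_1\ge0$, $n_1\le n_2$, Model Problem 1 asks for the minimizer $\omega_\nu$ over $\omega\in\mathcal P^{\beta\rho\kappa}([0,e^{-\rho\beta(\gamma^2-\kappa)}])$ of $$-\frac12\int_0^1\!\!\int_0^1\bigl(\ln|x^\nu-y^\nu|+\ln|x-y|\bigr)\omega(dx)\,\omega(dy)-\frac1\kappa\int_0^1\!\!\int_{n_1}^{n_2}\ln(1-x^{\nu}e^{-\beta\alpha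 u})\,du\,\omega(dx)-m_1\int_0^1\ln x\,\omega(dx),$$ under the assumption $n_1\alpha=-\nu\rho(\gamma^2-\kappa)$. Model Problem 2 asks for the minimizer $\omega_1$, over the same set, of the same functional with $\ln(1-x^\nu e^{-\beta\alpha u})$ replaced by $\ln(1-xe^{-\beta\alpha u})$, under the assumption $n_1\alpha=-\rho(\gamma^2-\kappa)$. **Claim.** In each case below, the listed parameters satisfy the assumptions of the indicated model problem, this model problem has a unique minimizer $\omega$ ($=\omega_\nu$ or $\omega_1$), the equilibrium measure $\mu$ exists and is unique, and $\mu$ is the pushforward of $\omega$ under $y\mapsto y^{1/\zeta}$, with $\zeta=\eta$ if $\theta>\eta$ and $\zeta=\theta$ if $\eta>\theta$. In terms of densities, $\mu(x)=\zeta x^{\zeta-1}\omega(x^\zeta)$ for almost every $x>0$ (for $\beta=0$ this is an identity between the densities of the absolutely continuous parts). Case 1: $\theta>\eta$; $\zeta=\eta$, $\nu=\theta/\eta$, $\rho=\eta$. * (i) $\xi\in(-\gamma^2,0]$: Model Problem 1 with $\kappa=\gamma^2-|\xi|$, $m_1=\frac{|\xi|}{\kappa}$, $n_1=-|\xi|$,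 $n_2=1-\gamma^2$, $\alpha=\theta$. * (ii) $\xi\in(0,1-\gamma^2]$: Model Problem 1 with $\kappa=\gamma^2$, $m_1=\frac{\theta\xi}{\eta\kappa}$, $n_1=0$, $n_2=1-\gamma^2-\xi$, $\alpha=\theta$. * (iii) $\xi\in(1-\gamma^2,1)$: Model Problem 2 with $\kappa=1-\xi$, $m_1=\frac{\theta\xi}{\eta\kappa}$, $n_1=1-\gamma^2-\xi$, $n_2=0$, $\alpha=\eta$. Case 2: $\eta>\theta$; $\zeta=\theta$, $\nu=\eta/\theta$, $\rho=\theta$. * (i) $\xi\in(-\gamma^2,0]$: Model Problem 2 with $\kappa=\gamma^2-|\xi|$, $m_1=\frac{|\xi|\eta}{\kappa\theta}$, $n_1=-|\xi|$, $n_2=1-\gamma^2$, $\alpha=\theta$. * (ii) $\xi\in(0,1-\gamma^2]$: Model Problem 2 with $\kappa=\gamma^2$, $m_1=\frac{\xi}{\kappa}$, $n_1=0$, $n_2=1-\gamma^2-\xi$, $\alpha=\theta$. * (iii) $\xi\in(1-\gamma^2,1)$: Model Problem 1 with $\kappa=1-\xi$, $m_1=\frac{\xi}{\kappa}$, $n_1=1-\gamma^2-\xi$,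 $n_2=0$, $\alpha=\eta$. -/

import Mathlib

open MeasureTheory Set
open scoped ENNReal

namespace MuttalibBorodin

/-- The function `-ln`, with the value `+∞` at `0`. In all functionals below it is applied to
numbers of `[0, 1]`, where `-ln` is nonnegative, so that energies take values in `[0, ∞]`. -/
noncomputable def negLog (x : ℝ) : ℝ≥0∞ :=
  if x ≤ 0 then ⊤ else ENNReal.ofReal (-Real.log x)

/-- The set `𝒫ᵇ([0, h])` of probability measures on `[0, h]` which have a density bounded by
`1 / (b x)`. For `b = 0` there is no constraint: `𝒫⁰([0, h]) = 𝒫([0, h])`. -/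
def constrainedMeasures (b h : ℝ) : Set (Measure ℝ) :=
  {μ | IsProbabilityMeasure μ ∧ μ (Icc 0 h)ᶜ = 0 ∧
    (0 < b → μ ≪ volume ∧
      ∀ᵐ x ∂volume, 0 < x → μ.rnDeriv volume x ≤ ENNReal.ofReal (1 / (b * x)))}

/-- `μ` is the unique minimizer of `F` over the set `C`. -/
def IsUniqueMinimizer (C : Set (Measure ℝ)) (F : Measure ℝ → ℝ≥0∞) (μ : Measure ℝ) : Prop :=
  μ ∈ C ∧ ∀ μ' ∈ C, μ' ≠ μ → F μ < F μ'

/-! ### The rate function of the slice at time `ξ` -/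

/-- The rescaled number `κ(ξ)` of particles of the slice at time `ξ`. -/
noncomputable def kappa (γ ξ : ℝ) : ℝ :=
  if ξ ≤ 0 then γ ^ 2 - |ξ| else if ξ ≤ 1 - γ ^ 2 then γ ^ 2 else 1 - ξ

/-- `-H`, the interaction energy. -/
noncomputable def interactionEnergy (γ η θ ξ : ℝ) (μ : Measure ℝ) : ℝ≥0∞ :=
  ENNReal.ofReal (kappa γ ξ ^ 2 / 2) *
    ∫⁻ x, ∫⁻ y, (negLog |x ^ θ - y ^ θ| + negLog |x ^ η - y ^ η|) ∂μ ∂μ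

/-- `-K`, the part of the potential energy that comes from the Pochhammer weights. -/
noncomputable def pochhammerEnergy (γ η θ β ξ : ℝ) (μ : Measure ℝ) : ℝ≥0∞ :=
  ENNReal.ofReal (kappa γ ξ) * ∫⁻ x,
    (if ξ ≤ 0 then
      ∫⁻ u in Ioc (γ ^ 2 - 1) |ξ|, negLog (1 - x ^ θ * Real.exp (β * θ * u))
    else if ξ ≤ 1 - γ ^ 2 then
      ∫⁻ u in Ioc 0 (1 - γ ^ 2 - ξ), negLog (1 - x ^ θ * Real.exp (-(β * θ * u)))
    else
      ∫⁻ u in Ioc (1 - γ ^ 2 - ξ) 0, negLog (1 - x ^ η * Real.exp (-(β * η * u)))) ∂μ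

/-- `-M`, the logarithmic part of the potential energy. -/
noncomputable def logEnergy (γ η θ ξ : ℝ) (μ : Measure ℝ) : ℝ≥0∞ :=
  ENNReal.ofReal (kappa γ ξ * (if ξ ≤ 0 then η * |ξ| else θ * ξ)) * ∫⁻ x, negLog x ∂μ

/-- The rate function `I = -H - K - M` of the slice at time `ξ`. -/
noncomputable def rateFunction (γ η θ β ξ : ℝ) (μ : Measure ℝ) : ℝ≥0∞ :=
  interactionEnergy γ η θ ξ μ + pochhammerEnergy γ η θ β ξ μ + logEnergy γ η θ ξ μ

/-- The set of limits of the empirical measures of the slice at time `ξ`, over which the rate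
function is minimized. -/
noncomputable def sliceMeasures (γ β ξ : ℝ) : Set (Measure ℝ) :=
  constrainedMeasures (β * kappa γ ξ) (Real.exp (-(β * (γ ^ 2 - kappa γ ξ))))

/-- `μ` is the equilibrium measure of the slice at time `ξ`. -/
def IsEquilibriumMeasure (γ η θ β ξ : ℝ) (μ : Measure ℝ) : Prop :=
  IsUniqueMinimizer (sliceMeasures γ β ξ) (rateFunction γ η θ β ξ) μ

/-! ### The two model problems -/

/-- The parameters of a model problem. -/
structure ModelParameters where
  ν : ℝ
  κ : ℝ
  m₁ : ℝ
  n₁ : ℝ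
  n₂ : ℝ
  α : ℝ
  ρ : ℝ

namespace ModelParameters

/-- The functional of the first model problem, with potential `ln (1 - x ^ ν e ^ (-β α u))`. -/
noncomputable def firstFunctional (p : ModelParameters) (β : ℝ) (ω : Measure ℝ) : ℝ≥0∞ :=
  ENNReal.ofReal (1 / 2) *
      ∫⁻ x in Icc 0 1, ∫⁻ y in Icc 0 1, (negLog |x ^ p.ν - y ^ p.ν| + negLog |x - y|) ∂ω ∂ω
    + ENNReal.ofReal (1 / p.κ) *
      ∫⁻ x in Icc 0 1, (∫⁻ u in Ioc p.n₁ p.n₂,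
        negLog (1 - x ^ p.ν * Real.exp (-(β * p.α * u)))) ∂ω
    + ENNReal.ofReal p.m₁ * ∫⁻ x in Icc 0 1, negLog x ∂ω

/-- The functional of the second model problem, with potential `ln (1 - x e ^ (-β α u))`. -/
noncomputable def secondFunctional (p : ModelParameters) (β : ℝ) (ω : Measure ℝ) : ℝ≥0∞ :=
  ENNReal.ofReal (1 / 2) *
      ∫⁻ x in Icc 0 1, ∫⁻ y in Icc 0 1, (negLog |x ^ p.ν - y ^ p.ν| + negLog |x - y|) ∂ω ∂ω
    + ENNReal.ofReal (1 / p.κ) *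
      ∫⁻ x in Icc 0 1, (∫⁻ u in Ioc p.n₁ p.n₂,
        negLog (1 - x * Real.exp (-(β * p.α * u)))) ∂ω
    + ENNReal.ofReal p.m₁ * ∫⁻ x in Icc 0 1, negLog x ∂ω

/-- The set `𝒫^{βρκ}([0, e^{-ρβ(γ² - κ)}])` of competitors in either model problem. -/
noncomputable def competitors (p : ModelParameters) (γ β : ℝ) : Set (Measure ℝ) :=
  constrainedMeasures (β * p.ρ * p.κ) (Real.exp (-(p.ρ * β * (γ ^ 2 - p.κ))))

/-- The standing assumptions common to both model problems. -/
def Standing (p : ModelParameters) : Prop :=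
  1 < p.ν ∧ 0 < p.κ ∧ 0 < p.α ∧ 0 < p.ρ ∧ 0 ≤ p.m₁ ∧ p.n₁ ≤ p.n₂

/-- The parameters are admissible for the first model problem: the last condition says that the
zero of `1 - x ^ ν e ^ (-β α n₁)` is the right end point of the interval of the competitors. -/
def FirstAdmissible (p : ModelParameters) (γ : ℝ) : Prop :=
  p.Standing ∧ p.n₁ * p.α = -(p.ν * p.ρ * (γ ^ 2 - p.κ))

/-- The parameters are admissible for the second model problem: the last condition says that the
zero of `1 - x e ^ (-β α n₁)` is the right end point of the interval of the competitors. -/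
def SecondAdmissible (p : ModelParameters) (γ : ℝ) : Prop :=
  p.Standing ∧ p.n₁ * p.α = -(p.ρ * (γ ^ 2 - p.κ))

/-- `ω` is the solution of the first model problem. -/
def IsFirstSolution (p : ModelParameters) (γ β : ℝ) (ω : Measure ℝ) : Prop :=
  IsUniqueMinimizer (p.competitors γ β) (p.firstFunctional β) ω

/-- `ω` is the solution of the second model problem. -/
def IsSecondSolution (p : ModelParameters) (γ β : ℝ) (ω : Measure ℝ) : Prop :=
  IsUniqueMinimizer (p.competitors γ β) (p.secondFunctional β) ω

end ModelParameters

/-- `μ` is the image of `ω` under `y ↦ y ^ (1 / ζ)`, and the densities satisfy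
`μ(x) = ζ x ^ (ζ - 1) ω(x ^ ζ)` for almost every `x > 0`. -/
def IsPowerPushforward (ζ : ℝ) (ω μ : Measure ℝ) : Prop :=
  μ = ω.map (fun y => y ^ (1 / ζ)) ∧
    ∀ᵐ x ∂volume, 0 < x →
      μ.rnDeriv volume x = ENNReal.ofReal (ζ * x ^ (ζ - 1)) * ω.rnDeriv volume (x ^ ζ)

/-- The first model problem with parameters `p` is admissible and has a solution, the slice at
time `ξ` has an equilibrium measure, and the latter is the transform of the former with
exponent `ζ`. -/
def RecoveredFromFirst (γ η θ β ξ ζ : ℝ) (p : ModelParameters) : Prop :=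
  p.FirstAdmissible γ ∧ ∃ ω μ : Measure ℝ, p.IsFirstSolution γ β ω ∧
    IsEquilibriumMeasure γ η θ β ξ μ ∧ IsPowerPushforward ζ ω μ

/-- The same for the second model problem. -/
def RecoveredFromSecond (γ η θ β ξ ζ : ℝ) (p : ModelParameters) : Prop :=
  p.SecondAdmissible γ ∧ ∃ ω μ : Measure ℝ, p.IsSecondSolution γ β ω ∧
    IsEquilibriumMeasure γ η θ β ξ μ ∧ IsPowerPushforward ζ ω μ

end MuttalibBorodin

namespace MuttalibBorodin

/-! ### The function `negLog` -/

/-! The power map `x ↦ x ^ ζ` carries everything. It sends `[0, h]` to `[0, h ^ ζ]` and `dx / (b x)`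
to `dx / (b ζ x)`, so it is a bijection between the two sets of competitors, and the rate function
at `μ` is `κ²` times the model functional at the image of `μ` (`fieldEnergy_map_rpow`,
`IsUniqueMinimizer.map_rpow`). The smaller of `θ`, `η` becomes the exponent `1`, the larger one
becomes `ν`. The first or the second model problem appears according as the exponent in the
Pochhammer weight is the larger or the smaller one. What remains is that a model problem has a
unique minimizer (`exists_isUniqueMinimizer`).

Uniqueness rests on strict convexity of the logarithmic energy on `[0, 1]`. For `0 ≤ d ≤ 1`, `-ln d
= ∫₀¹ r⁻² (r - d)⁺ dr + (1 - d)`, and `(r - |x - y|)⁺` is the length of the set of `t` with `x, y ∈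
(t, t + r)`. Hence the mutual energy of `μ` and `μ'` is an integral of `μ (t, t + r) * μ' (t, t +
r)` against a positive measure in `(r, t)`. Convexity is then `2ab ≤ a² + b²`, and the equality case
at `r = 1` recovers the distribution functions (`eq_of_mutualEnergy_le`).

Existence is the direct method. The intervals being open, the same formula, the portmanteau theorem
and Fatou's lemma give weak lower semicontinuity. The density bound passes to weak limits except for
possible mass at `0`, and finite energy excludes an atom there. All kernels are nonnegative on `[0,
1]`, so Tonelli applies throughout without integrability conditions. -/

lemma negLog_zero : negLog 0 = ⊤ := by simp [negLog]

lemma negLog_of_pos {x : ℝ} (hx : 0 < x) : negLog x = ENNReal.ofReal (-Real.log x) := by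
  simp [negLog, not_le.2 hx]

lemma antitone_negLog : Antitone negLog := by
  intro x y hxy
  rcases le_or_gt x 0 with hx | hx
  · simp [negLog, hx]
  · rw [negLog_of_pos hx, negLog_of_pos (hx.trans_le hxy)]
    exact ENNReal.ofReal_le_ofReal (neg_le_neg (Real.log_le_log hx hxy))

@[fun_prop]
lemma measurable_negLog : Measurable negLog := antitone_negLog.measurable

lemma lowerSemicontinuous_negLog : LowerSemicontinuous negLog := by
  intro x c hc
  rcases le_or_gt x 0 with hx | hx
  · have hct : c < ⊤ := hc.trans_le le_top
    -- Below this threshold `negLog` is at least `c + 1`.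
    have hlt : x < Real.exp (-(c.toReal + 1)) := hx.trans_lt (Real.exp_pos _)
    filter_upwards [Iio_mem_nhds hlt] with y hy
    refine lt_of_lt_of_le ?_ (antitone_negLog (le_of_lt hy))
    rw [negLog_of_pos (Real.exp_pos _), Real.log_exp, neg_neg]
    rw [ENNReal.lt_ofReal_iff_toReal_lt hct.ne]
    linarith
  · have hcont : ContinuousAt (fun y => ENNReal.ofReal (-Real.log y)) x :=
      ENNReal.continuous_ofReal.continuousAt.comp (Real.continuousAt_log hx.ne').neg
    rw [negLog_of_pos hx] at hc
    filter_upwards [hcont.eventually (lt_mem_nhds hc), Ioi_mem_nhds hx] with y hy hy0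
    rwa [negLog_of_pos hy0]

lemma negLog_rpow {x p : ℝ} (hx : 0 ≤ x) (hp : 0 < p) :
    negLog (x ^ p) = ENNReal.ofReal p * negLog x := by
  rcases hx.eq_or_lt with rfl | hx
  · rw [Real.zero_rpow hp.ne', negLog_zero, ENNReal.mul_top (by simpa using hp)]
  · rw [negLog_of_pos hx, negLog_of_pos (Real.rpow_pos_of_pos hx p), Real.log_rpow hx,
      ← ENNReal.ofReal_mul hp.le]
    congr 1
    ring

/-! ### The logarithmic kernel as a superposition of products of indicator functions -/

/-- An antiderivative of `(r - d) / r²` is `ln r + d / r`, so the integral over `[d, 1]` is `-ln d -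
(1 - d)`. -/
lemma lintegral_inv_sq_mul_sub {d : ℝ} (hd : 0 ≤ d) (hd1 : d ≤ 1) :
    (∫⁻ r in Ioc 0 1, ENNReal.ofReal (1 / r ^ 2) * ENNReal.ofReal (r - d))
      + ENNReal.ofReal (1 - d) = negLog d := by
  have hpos : ∀ d : ℝ, 0 < d → d ≤ 1 →
      (∫⁻ r in Ioc 0 1, ENNReal.ofReal (1 / r ^ 2) * ENNReal.ofReal (r - d))
        + ENNReal.ofReal (1 - d) = negLog d := by
    intro d hd hd1
    have hsplit : (∫⁻ r in Ioc 0 1, ENNReal.ofReal (1 / r ^ 2) * ENNReal.ofReal (r - d)) =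
        ∫⁻ r in Ioc d 1, ENNReal.ofReal ((r - d) / r ^ 2) := by
      rw [← Ioc_union_Ioc_eq_Ioc hd.le hd1,
        lintegral_union measurableSet_Ioc (Ioc_disjoint_Ioc_of_le le_rfl)]
      have h0 : (∫⁻ r in Ioc 0 d, ENNReal.ofReal (1 / r ^ 2) * ENNReal.ofReal (r - d)) = 0 := by
        rw [setLIntegral_congr_fun (g := fun _ => 0) measurableSet_Ioc, lintegral_zero]
        intro r hr
        simp [ENNReal.ofReal_of_nonpos (sub_nonpos.2 hr.2)]
      rw [h0, zero_add]
      refine setLIntegral_congr_fun measurableSet_Ioc fun r _ => ?_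
      rw [← ENNReal.ofReal_mul (by positivity)]
      congr 1
      ring
    have hcont : ContinuousOn (fun r : ℝ => (r - d) / r ^ 2) (uIcc d 1) := by
      rw [uIcc_of_le hd1]
      refine ContinuousOn.div (by fun_prop) (by fun_prop) fun r hr => ?_
      have := hd.trans_le hr.1
      positivity
    have hint := hcont.intervalIntegrable (μ := volume)
    have hval : ∫ r in d..1, (r - d) / r ^ 2 = -Real.log d - (1 - d) := by
      rw [intervalIntegral.integral_eq_sub_of_hasDerivAt (f := fun r => Real.log r + d / r) _ hint]
      · simp only [Real.log_one, div_self hd.ne']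
        ring
      · intro r hr
        rw [uIcc_of_le hd1] at hr
        have hr0 : r ≠ 0 := (hd.trans_le hr.1).ne'
        have h1 := (Real.hasDerivAt_log hr0).add ((hasDerivAt_inv hr0).const_mul d)
        refine (h1.congr_deriv ?_).congr_of_eventuallyEq ?_
        · field_simp
          ring
        · exact Filter.Eventually.of_forall fun y => by simp [div_eq_mul_inv]
    have hlog : 0 ≤ -Real.log d - (1 - d) := by
      linarith [Real.log_le_sub_one_of_pos hd]
    rw [hsplit, ← ofReal_integral_eq_lintegral_ofReal, ← intervalIntegral.integral_of_le hd1, hval,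
      ← ENNReal.ofReal_add hlog (by linarith), negLog_of_pos hd]
    · congr 1
      ring
    · exact (intervalIntegrable_iff_integrableOn_Ioc_of_le hd1).1 hint
    · refine (ae_restrict_mem measurableSet_Ioc).mono fun r hr => ?_
      exact div_nonneg (sub_nonneg.2 hr.1.le) (sq_nonneg r)
  rcases hd.eq_or_lt with rfl | hd
  -- At `d = 0` the left side dominates its value at `d = e ^ (-c)`, which is `c`, for every `c ≥
  -- 0`.
  · rw [negLog_zero, eq_top_iff]
    refine ENNReal.le_of_forall_nnreal_lt fun c _ => ?_
    have hc : (0 : ℝ) ≤ c := c.2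
    refine le_trans ?_ (le_trans (hpos (Real.exp (-c)) (Real.exp_pos _)
      (Real.exp_le_one_iff.2 (by linarith))).ge ?_)
    · rw [negLog_of_pos (Real.exp_pos _), Real.log_exp, neg_neg, ENNReal.ofReal_coe_nnreal]
    · gcongr <;> exact (Real.exp_pos _).le
  · exact hpos d hd hd1

/-- The measure of the pairs `(r, t)` in the decomposition of the logarithmic kernel into
products of indicator functions of the intervals `(t, t + r)`. -/
noncomputable def kernelMeasure : Measure (ℝ × ℝ) :=
  ((volume.restrict (Ioc 0 1)).withDensity (fun r => ENNReal.ofReal (1 / r ^ 2))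
    + Measure.dirac 1).prod volume

instance : SFinite kernelMeasure := by
  unfold kernelMeasure
  infer_instance

/-- The mutual logarithmic energy of two measures on `[0, 1]`. -/
noncomputable def mutualEnergy (μ μ' : Measure ℝ) : ℝ≥0∞ :=
  ∫⁻ p, μ (Ioo p.2 (p.2 + p.1)) * μ' (Ioo p.2 (p.2 + p.1)) ∂kernelMeasure

lemma lintegral_kernelMeasure {f : ℝ × ℝ → ℝ≥0∞} (hf : Measurable f) :
    ∫⁻ p, f p ∂kernelMeasure =
      (∫⁻ r in Ioc 0 1, ENNReal.ofReal (1 / r ^ 2) * ∫⁻ t, f (r, t)) + ∫⁻ t, f (1, t) := by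
  rw [kernelMeasure, lintegral_prod _ hf.aemeasurable, lintegral_add_measure,
    lintegral_dirac' _ hf.lintegral_prod_right',
    lintegral_withDensity_eq_lintegral_mul _ (by fun_prop) hf.lintegral_prod_right']
  rfl

lemma measurableSet_intervals :
    MeasurableSet {q : (ℝ × ℝ) × ℝ | q.2 ∈ Ioo q.1.2 (q.1.2 + q.1.1)} := by
  have h1 : MeasurableSet {q : (ℝ × ℝ) × ℝ | q.1.2 < q.2} :=
    measurableSet_lt (by fun_prop) (by fun_prop)
  have h2 : MeasurableSet {q : (ℝ × ℝ) × ℝ | q.2 < q.1.2 + q.1.1} :=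
    measurableSet_lt (by fun_prop) (by fun_prop)
  exact h1.inter h2

lemma measurable_measure_interval (μ : Measure ℝ) [SFinite μ] :
    Measurable (fun p : ℝ × ℝ => μ (Ioo p.2 (p.2 + p.1))) :=
  measurable_measure_prodMk_left measurableSet_intervals

/-- Both points lie in `(t, t + r)` exactly when `max x y - r < t < min x y`. -/
lemma volume_setOf_mem_interval (x y r : ℝ) :
    ∫⁻ t, (Ioo t (t + r)).indicator 1 x * (Ioo t (t + r)).indicator 1 y =
      ENNReal.ofReal (r - |x - y|) := by
  have : ∀ t, (Ioo t (t + r)).indicator (1 : ℝ → ℝ≥0∞) x * (Ioo t (t + r)).indicator 1 y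
      = (Ioo (max x y - r) (min x y)).indicator 1 t := by
    intro t
    by_cases h : t ∈ Ioo (max x y - r) (min x y)
    · have h' := h
      simp only [mem_Ioo, sub_lt_iff_lt_add, max_lt_iff, lt_min_iff] at h'
      simp [h, h'.1.1, h'.1.2, h'.2.1, h'.2.2]
    · rw [indicator_of_notMem h]
      simp only [mem_Ioo, sub_lt_iff_lt_add, max_lt_iff, lt_min_iff, not_and_or] at h
      simp only [mul_eq_zero, indicator_apply_eq_zero, mem_Ioo]
      by_contra! h'
      grind
  simp_rw [this]
  rw [lintegral_indicator_one measurableSet_Ioo, Real.volume_Ioo]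
  congr 1
  rw [← max_sub_min_eq_abs' x y]
  ring

/-- Tonelli applied to the decomposition of the kernel. The supports are in `[0, 1]` so that `|x -
y| ≤ 1`, the range in which the decomposition holds. -/
lemma lintegral_negLog_eq_mutualEnergy {μ μ' : Measure ℝ} [SFinite μ] [SFinite μ']
    (hμ : μ (Icc 0 1)ᶜ = 0) (hμ' : μ' (Icc 0 1)ᶜ = 0) :
    ∫⁻ x, ∫⁻ y, negLog |x - y| ∂μ' ∂μ = mutualEnergy μ μ' := by
  have hker : ∀ x ∈ Icc (0 : ℝ) 1, ∀ y ∈ Icc (0 : ℝ) 1, negLog |x - y| =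
      ∫⁻ p, (Ioo p.2 (p.2 + p.1)).indicator 1 x * (Ioo p.2 (p.2 + p.1)).indicator 1 y
        ∂kernelMeasure := by
    intro x hx y hy
    have hm : ∀ x : ℝ, Measurable fun p : ℝ × ℝ =>
        (Ioo p.2 (p.2 + p.1)).indicator (1 : ℝ → ℝ≥0∞) x := fun x =>
      (measurable_const (a := (1 : ℝ≥0∞))).indicator
        (measurableSet_intervals.preimage (measurable_prodMk_right (y := x)))
    rw [lintegral_kernelMeasure (by exact (hm x).mul (hm y))]
    simp only [volume_setOf_mem_interval]
    rw [lintegral_inv_sq_mul_sub (abs_nonneg _)]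
    rw [abs_le]
    constructor <;> linarith [hx.1, hx.2, hy.1, hy.2]
  have hm : Measurable fun q : (ℝ × ℝ) × ℝ =>
      (Ioo q.1.2 (q.1.2 + q.1.1)).indicator (1 : ℝ → ℝ≥0∞) q.2 :=
    (measurable_const (a := (1 : ℝ≥0∞))).indicator measurableSet_intervals
  have hae : ∀ᵐ x ∂μ, x ∈ Icc (0 : ℝ) 1 := hμ
  have hae' : ∀ᵐ x ∂μ', x ∈ Icc (0 : ℝ) 1 := hμ'
  calc ∫⁻ x, ∫⁻ y, negLog |x - y| ∂μ' ∂μ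
      = ∫⁻ x, ∫⁻ y, ∫⁻ p, (Ioo p.2 (p.2 + p.1)).indicator 1 x *
          (Ioo p.2 (p.2 + p.1)).indicator 1 y ∂kernelMeasure ∂μ' ∂μ := by
        refine lintegral_congr_ae ?_
        filter_upwards [hae] with x hx
        refine lintegral_congr_ae ?_
        filter_upwards [hae'] with y hy using hker x hx y hy
    _ = ∫⁻ x, ∫⁻ p, (Ioo p.2 (p.2 + p.1)).indicator 1 x * μ' (Ioo p.2 (p.2 + p.1))
          ∂kernelMeasure ∂μ := by
        refine lintegral_congr fun x => ?_
        rw [lintegral_lintegral_swap]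
        · refine lintegral_congr fun p => ?_
          rw [lintegral_const_mul _ (measurable_one.indicator measurableSet_Ioo),
            lintegral_indicator_one measurableSet_Ioo]
        · refine Measurable.aemeasurable ?_
          exact (hm.comp (f := fun q : ℝ × ℝ × ℝ => (q.2, x)) (by fun_prop)).mul
            (hm.comp (f := fun q : ℝ × ℝ × ℝ => (q.2, q.1)) (by fun_prop))
    _ = mutualEnergy μ μ' := by
        rw [lintegral_lintegral_swap]
        · refine lintegral_congr fun p => ?_
          rw [lintegral_mul_const _ (measurable_one.indicator measurableSet_Ioo),
            lintegral_indicator_one measurableSet_Ioo]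
        · refine Measurable.aemeasurable ?_
          exact (hm.comp (f := fun q : ℝ × ℝ × ℝ => (q.2, q.1)) (by fun_prop)).mul
            ((measurable_measure_interval μ').comp measurable_snd)

/-! ### Convexity of the energy -/

lemma ENNReal.two_mul_mul_le (a b : ℝ≥0∞) : 2 * (a * b) ≤ a * a + b * b := by
  rcases eq_or_ne a ⊤ with rfl | ha
  · simp
  rcases eq_or_ne b ⊤ with rfl | hb
  · simp
  lift a to NNReal using ha
  lift b to NNReal using hb
  norm_cast
  rw [← NNReal.coe_le_coe]
  push_cast
  nlinarith [sq_nonneg ((a : ℝ) - b)]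

lemma ENNReal.eq_of_two_mul_mul_eq {a b : ℝ≥0∞} (ha : a ≠ ⊤) (hb : b ≠ ⊤)
    (h : 2 * (a * b) = a * a + b * b) : a = b := by
  lift a to NNReal using ha
  lift b to NNReal using hb
  norm_cast at h ⊢
  have h' : (2 * (a * b) : ℝ) = a * a + b * b := by exact_mod_cast h
  refine NNReal.coe_injective (sub_eq_zero.1 (pow_eq_zero_iff two_ne_zero |>.1 ?_))
  linear_combination -h'

lemma two_mul_mutualEnergy_le (μ μ' : Measure ℝ) [SFinite μ] [SFinite μ'] :
    2 * mutualEnergy μ μ' ≤ mutualEnergy μ μ + mutualEnergy μ' μ' := by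
  have h := measurable_measure_interval μ
  have h' := measurable_measure_interval μ'
  unfold mutualEnergy
  rw [← lintegral_const_mul _ (by exact h.mul h'), ← lintegral_add_left (by exact h.mul h)]
  exact lintegral_mono fun p => ENNReal.two_mul_mul_le _ _

/-- Equality in the integrated inequality `2ab ≤ a² + b²`, with finite integrals, forces `a = b`
almost everywhere. For measures on `[0, 1]` and `-1 < t < 0`, the interval `(t, t + 1)` has the same
mass as `(-∞, t + 1)`, so intervals of length `1` already determine the measure. -/
lemma eq_of_mutualEnergy_le {μ μ' : Measure ℝ} [IsProbabilityMeasure μ] [IsProbabilityMeasure μ']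
    (hμ : μ (Icc 0 1)ᶜ = 0) (hμ' : μ' (Icc 0 1)ᶜ = 0)
    (hfin : mutualEnergy μ μ ≠ ⊤) (hfin' : mutualEnergy μ' μ' ≠ ⊤)
    (hle : mutualEnergy μ μ + mutualEnergy μ' μ' ≤ 2 * mutualEnergy μ μ') : μ = μ' := by
  have h := measurable_measure_interval μ
  have h' := measurable_measure_interval μ'
  have hsum : ∫⁻ p, (μ (Ioo p.2 (p.2 + p.1)) * μ (Ioo p.2 (p.2 + p.1)) +
      μ' (Ioo p.2 (p.2 + p.1)) * μ' (Ioo p.2 (p.2 + p.1))) ∂kernelMeasure =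
      mutualEnergy μ μ + mutualEnergy μ' μ' := lintegral_add_left (by exact h.mul h) _
  have hmul : ∫⁻ p, 2 * (μ (Ioo p.2 (p.2 + p.1)) * μ' (Ioo p.2 (p.2 + p.1))) ∂kernelMeasure =
      2 * mutualEnergy μ μ' := lintegral_const_mul _ (by exact h.mul h')
  have hae := ae_eq_of_ae_le_of_lintegral_le (μ := kernelMeasure)
    (Filter.Eventually.of_forall fun p => ENNReal.two_mul_mul_le
      (μ (Ioo p.2 (p.2 + p.1))) (μ' (Ioo p.2 (p.2 + p.1))))
    (by
      rw [hmul]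
      refine ne_top_of_le_ne_top ?_ (two_mul_mutualEnergy_le μ μ')
      exact ENNReal.add_ne_top.2 ⟨hfin, hfin'⟩)
    (by exact ((h.mul h).add (h'.mul h')).aemeasurable) (by rw [hsum, hmul]; exact hle)
  -- The atom of `kernelMeasure` at `r = 1` gives the equality at that single length.
  have hae1 : ∀ᵐ t : ℝ, μ (Ioo t (t + 1)) = μ' (Ioo t (t + 1)) := by
    have h1 := Measure.ae_ae_of_ae_prod hae
    rw [ae_add_measure_iff, ae_dirac_eq, Filter.eventually_pure] at h1
    filter_upwards [h1.2] with t ht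
    exact ENNReal.eq_of_two_mul_mul_eq (measure_ne_top _ _) (measure_ne_top _ _) ht
  clear hae hsum hmul h h' hle hfin hfin'
  have hcdf : ∀ {μ μ' : Measure ℝ} [IsProbabilityMeasure μ] [IsProbabilityMeasure μ'],
      μ (Icc 0 1)ᶜ = 0 → μ' (Icc 0 1)ᶜ = 0 →
      (∀ᵐ t : ℝ, μ (Ioo t (t + 1)) = μ' (Ioo t (t + 1))) → ∀ a, μ (Iic a) ≤ μ' (Iic a) := by
    intro μ μ' _ _ hμ hμ' hae a
    rcases lt_or_ge a 0 with ha | ha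
    · have h0 : Iic a ⊆ (Icc 0 1)ᶜ := fun x hx hx' => (lt_of_le_of_lt hx ha).not_ge hx'.1
      rw [measure_mono_null h0 hμ]
      exact zero_le
    rcases le_or_gt 1 a with ha1 | ha1
    · have : μ' (Iic a) = 1 := by
        rw [prob_compl_eq_zero_iff measurableSet_Icc] at hμ'
        exact le_antisymm prob_le_one (hμ' ▸ measure_mono fun x hx => hx.2.trans ha1)
      rw [this]
      exact prob_le_one
    -- The equality is known only for almost every `t`, so right continuity of the distribution
    -- function is needed to reach every `a`.
    have hlim : Filter.Tendsto (μ' ∘ Iic) (nhdsWithin a (Ioi a)) (nhds (μ' (Iic a))) := by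
      have := tendsto_measure_biInter_gt (μ := μ') (s := fun r : ℝ => Iic r) (a := a)
        (fun r _ => measurableSet_Iic.nullMeasurableSet) (fun i j _ hij => Iic_subset_Iic.2 hij)
        ⟨a + 1, by simp, measure_ne_top _ _⟩
      rwa [show ⋂ r > a, Iic r = Iic a by
        ext x
        simpa using forall_gt_imp_ge_iff_le_of_dense] at this
    refine ge_of_tendsto hlim ?_
    filter_upwards [Ioo_mem_nhdsGT ha1] with b hb
    -- Such a `t` satisfies `t < 0` and `a < t + 1 < b`, so `[0, a] ⊆ (t, t + 1) ⊆ (-∞, b]`.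
    obtain ⟨t, ht, hta⟩ : ∃ t ∈ Ioo (a - 1) (b - 1), μ (Ioo t (t + 1)) = μ' (Ioo t (t + 1)) := by
      by_contra! hcon
      have h0 : volume (Ioo (a - 1) (b - 1)) = 0 := measure_mono_null hcon hae
      rw [Real.volume_Ioo, ENNReal.ofReal_eq_zero] at h0
      linarith [hb.1]
    calc μ (Iic a) ≤ μ (Ioo t (t + 1) ∪ (Icc 0 1)ᶜ) := by
          refine measure_mono fun x hx => ?_
          simp only [mem_union, mem_Ioo, mem_compl_iff, mem_Icc, mem_Iic] at hx ⊢
          grind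
      _ ≤ μ (Ioo t (t + 1)) := by
          refine (measure_union_le _ _).trans ?_
          rw [hμ, add_zero]
      _ = μ' (Ioo t (t + 1)) := hta
      _ ≤ μ' (Iic b) := measure_mono fun x hx => by
          simp only [mem_Ioo, mem_Iic] at hx ⊢
          linarith [ht.2]
  refine Measure.ext_of_Iic _ _ fun a => le_antisymm (hcdf hμ hμ' hae1 a)
    (hcdf hμ' hμ (hae1.mono fun t ht => ht.symm) a)

/-! ### Lower semicontinuity -/

/-- Fatou's lemma along the neighbourhood filter, which is countably generated by first
countability. -/
lemma lowerSemicontinuous_lintegral {X P : Type*} [TopologicalSpace X] [FirstCountableTopology X]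
    [MeasurableSpace P] {τ : Measure P} {F : X → P → ℝ≥0∞} (hm : ∀ x, Measurable (F x))
    (hF : ∀ p, LowerSemicontinuous fun x => F x p) :
    LowerSemicontinuous fun x => ∫⁻ p, F x p ∂τ := by
  rw [lowerSemicontinuous_iff_le_liminf]
  intro x
  refine le_trans (lintegral_mono fun p => ?_) (lintegral_liminf_le (u := nhds x) hm)
  exact lowerSemicontinuous_iff_le_liminf.1 (hF p) x

lemma lowerSemicontinuous_measure_of_isOpen {U : Set ℝ} (hU : IsOpen U) :
    LowerSemicontinuous fun μ : ProbabilityMeasure ℝ => (μ : Measure ℝ) U := by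
  rw [lowerSemicontinuous_iff_le_liminf]
  exact fun μ => ProbabilityMeasure.le_liminf_measure_open_of_tendsto Filter.tendsto_id hU

lemma lintegral_indicator_ofReal_lt (c : ℝ≥0∞) :
    ∫⁻ t in Ioi (0 : ℝ), {t : ℝ | ENNReal.ofReal t < c}.indicator 1 t = c := by
  have hms : MeasurableSet {t : ℝ | ENNReal.ofReal t < c} :=
    measurableSet_lt ENNReal.measurable_ofReal measurable_const
  rw [lintegral_indicator_one hms, Measure.restrict_apply hms]
  rcases eq_or_ne c ⊤ with rfl | hc
  · simp
  · have : {t : ℝ | ENNReal.ofReal t < c} ∩ Ioi 0 = Ioo 0 c.toReal := by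
      ext t
      simp only [mem_inter_iff, mem_ofPred_eq, mem_Ioi, mem_Ioo]
      constructor
      · rintro ⟨h1, h2⟩
        exact ⟨h2, (ENNReal.ofReal_lt_iff_lt_toReal h2.le hc).1 h1⟩
      · rintro ⟨h1, h2⟩
        exact ⟨(ENNReal.ofReal_lt_iff_lt_toReal h1.le hc).2 h2, h1⟩
    rw [this, Real.volume_Ioo, sub_zero, ENNReal.ofReal_toReal hc]

/-- The layer-cake formula in a form that allows `V` to take the value `∞`. -/
lemma lintegral_eq_lintegral_measure_ofReal_lt {V : ℝ → ℝ≥0∞} (hV : Measurable V)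
    (μ : Measure ℝ) [SFinite μ] :
    ∫⁻ x, V x ∂μ = ∫⁻ t in Ioi (0 : ℝ), μ (V ⁻¹' Ioi (ENNReal.ofReal t)) := by
  have hms : MeasurableSet {q : ℝ × ℝ | ENNReal.ofReal q.2 < V q.1} :=
    measurableSet_lt (by fun_prop) (by fun_prop)
  have hmi : Measurable (Function.uncurry fun (x t : ℝ) =>
      {t : ℝ | ENNReal.ofReal t < V x}.indicator (1 : ℝ → ℝ≥0∞) t) :=
    (measurable_const (a := (1 : ℝ≥0∞))).indicator hms
  calc ∫⁻ x, V x ∂μ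
      = ∫⁻ x, (∫⁻ t in Ioi (0 : ℝ), {t : ℝ | ENNReal.ofReal t < V x}.indicator 1 t) ∂μ :=
        lintegral_congr fun x => (lintegral_indicator_ofReal_lt (V x)).symm
    _ = ∫⁻ t in Ioi (0 : ℝ), ∫⁻ x, {t : ℝ | ENNReal.ofReal t < V x}.indicator 1 t ∂μ :=
        lintegral_lintegral_swap hmi.aemeasurable
    _ = _ := lintegral_congr fun t =>
        lintegral_indicator_one (s := V ⁻¹' Ioi (ENNReal.ofReal t)) (hV measurableSet_Ioi)

/-- The sets `{V > t}` are open, so the portmanteau theorem applies to each layer and Fatou's lemma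
to their integral. -/
lemma lowerSemicontinuous_lintegral_measure {V : ℝ → ℝ≥0∞} (hV : LowerSemicontinuous V) :
    LowerSemicontinuous fun μ : ProbabilityMeasure ℝ => ∫⁻ x, V x ∂(μ : Measure ℝ) := by
  simp_rw [lintegral_eq_lintegral_measure_ofReal_lt hV.measurable]
  refine lowerSemicontinuous_lintegral (fun μ => ?_) fun t =>
    lowerSemicontinuous_measure_of_isOpen (hV.isOpen_preimage _)
  refine Antitone.measurable fun s t hst => measure_mono fun x hx => ?_
  exact lt_of_le_of_lt (ENNReal.ofReal_le_ofReal hst) hx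

lemma lowerSemicontinuous_mutualEnergy_self {f : ℝ → ℝ} (hf : Continuous f) :
    LowerSemicontinuous fun μ : ProbabilityMeasure ℝ =>
      mutualEnergy ((μ : Measure ℝ).map f) ((μ : Measure ℝ).map f) := by
  refine lowerSemicontinuous_lintegral (fun μ => ?_) fun p => ?_
  · exact (measurable_measure_interval _).mul (measurable_measure_interval _)
  · simp_rw [Measure.map_apply hf.measurable measurableSet_Ioo]
    have h := lowerSemicontinuous_iff_le_liminf.1
      (lowerSemicontinuous_measure_of_isOpen (isOpen_Ioo (a := p.2) (b := p.2 + p.1) |>.preimage hf))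
    rw [lowerSemicontinuous_iff_le_liminf]
    intro μ
    refine (mul_le_mul' (h μ) (h μ)).trans ?_
    exact ENNReal.le_liminf_mul

lemma LowerSemicontinuous.const_mul_ennreal {X : Type*} [TopologicalSpace X] {f : X → ℝ≥0∞}
    (hf : LowerSemicontinuous f) {c : ℝ≥0∞} (hc : c ≠ ⊤) :
    LowerSemicontinuous fun x => c * f x :=
  (ENNReal.continuous_const_mul hc).comp_lowerSemicontinuous hf fun _ _ h => mul_le_mul_right h c

/-! ### The measure `dx / (b x)` -/

/-- The measure `dx / (b x)` on `(0, ∞)`. -/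
noncomputable def logMeasure (b : ℝ) : Measure ℝ :=
  (volume.restrict (Ioi 0)).withDensity fun x => ENNReal.ofReal (1 / (b * x))

lemma logMeasure_apply (b : ℝ) {s : Set ℝ} (hs : MeasurableSet s) :
    logMeasure b s = ∫⁻ x in s ∩ Ioi 0, ENNReal.ofReal (1 / (b * x)) := by
  rw [logMeasure, withDensity_apply _ hs, Measure.restrict_restrict hs]

lemma logMeasure_absolutelyContinuous (b : ℝ) : logMeasure b ≪ volume :=
  (withDensity_absolutelyContinuous _ _).trans (Measure.absolutelyContinuous_of_le Measure.restrict_le_self)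

/-- Domination by a fixed measure, unlike a bound on the Radon–Nikodym derivative, is directly
preserved by images and can be tested on open sets. Nothing is lost on `(-∞, 0]`, which is null by
the support condition and absolute continuity. -/
lemma mem_constrainedMeasures_iff {b h : ℝ} {μ : Measure ℝ} :
    μ ∈ constrainedMeasures b h ↔
      IsProbabilityMeasure μ ∧ μ (Icc 0 h)ᶜ = 0 ∧ (0 < b → μ ≤ logMeasure b) := by
  refine and_congr_right fun hprob => and_congr_right fun hsupp => imp_congr_right fun hb => ?_
  constructor
  · rintro ⟨hac, hae⟩
    have hneg : μ (Iic 0) = 0 := by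
      have h1 : μ {0} = 0 := hac (by simp)
      refine measure_mono_null (t := {0} ∪ (Icc 0 h)ᶜ) (fun x hx => ?_)
        (measure_union_null h1 hsupp)
      simp only [mem_Iic, mem_union, mem_singleton_iff, mem_compl_iff, mem_Icc] at hx ⊢
      grind
    refine Measure.le_iff.2 fun s hs => ?_
    calc μ s ≤ μ (s ∩ Ioi 0) + μ (Iic 0) := by
          refine (measure_mono fun x hx => ?_).trans (measure_union_le _ _)
          rcases le_or_gt x 0 with h | h
          exacts [Or.inr h, Or.inl ⟨hx, h⟩]
      _ = μ (s ∩ Ioi 0) := by rw [hneg, add_zero]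
      _ = ∫⁻ x in s ∩ Ioi 0, μ.rnDeriv volume x := (Measure.setLIntegral_rnDeriv hac _).symm
      _ ≤ ∫⁻ x in s ∩ Ioi 0, ENNReal.ofReal (1 / (b * x)) :=
          setLIntegral_mono_ae (by fun_prop) (hae.mono fun x hx hxs => hx hxs.2)
      _ = logMeasure b s := (logMeasure_apply b hs).symm
  · intro hle
    have hac : μ ≪ volume :=
      (Measure.absolutelyContinuous_of_le hle).trans (logMeasure_absolutelyContinuous b)
    refine ⟨hac, ?_⟩
    have hae : ∀ᵐ x ∂volume.restrict (Ioi 0),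
        μ.rnDeriv volume x ≤ ENNReal.ofReal (1 / (b * x)) := ?_
    · exact (ae_restrict_iff' measurableSet_Ioi).1 hae
    refine ae_le_of_forall_setLIntegral_le_of_sigmaFinite (Measure.measurable_rnDeriv _ _)
      fun s hs _ => ?_
    rw [Measure.restrict_restrict hs, Measure.setLIntegral_rnDeriv hac, ← logMeasure_apply b hs]
    exact (measure_mono inter_subset_left).trans (hle s)

lemma measure_le_of_forall_isOpen {μ ν : Measure ℝ} [ν.OuterRegular]
    (hle : ∀ U : Set ℝ, IsOpen U → μ U ≤ ν U) : μ ≤ ν := by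
  refine Measure.le_iff.2 fun s _ => ?_
  rw [s.measure_eq_iInf_isOpen ν]
  exact le_iInf fun U => le_iInf fun hU => le_iInf fun hUo => (measure_mono hU).trans (hle U hUo)

lemma logMeasure_restrict_Ioi_le {b : ℝ} (hb : 0 < b) {δ : ℝ} (hδ : 0 < δ) :
    (logMeasure b).restrict (Ioi δ) ≤ ENNReal.ofReal (1 / (b * δ)) • volume := by
  refine Measure.le_iff.2 fun s hs => ?_
  rw [Measure.restrict_apply hs, logMeasure_apply b (hs.inter measurableSet_Ioi),
    Measure.smul_apply, smul_eq_mul]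
  calc ∫⁻ x in s ∩ Ioi δ ∩ Ioi 0, ENNReal.ofReal (1 / (b * x))
      ≤ ∫⁻ _ in s ∩ Ioi δ ∩ Ioi 0, ENNReal.ofReal (1 / (b * δ)) := by
        refine setLIntegral_mono measurable_const fun x hx => ?_
        have hx' : δ < x := hx.1.2
        gcongr
    _ = ENNReal.ofReal (1 / (b * δ)) * volume (s ∩ Ioi δ ∩ Ioi 0) := setLIntegral_const _ _
    _ ≤ ENNReal.ofReal (1 / (b * δ)) * volume s := by
        gcongr
        exact fun x hx => hx.1.1

lemma isLocallyFiniteMeasure_logMeasure_restrict_Ioi {b : ℝ} (hb : 0 < b) {δ : ℝ} (hδ : 0 < δ) :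
    IsLocallyFiniteMeasure ((logMeasure b).restrict (Ioi δ)) := by
  have : IsLocallyFiniteMeasure (ENNReal.ofReal (1 / (b * δ)) • (volume : Measure ℝ)) :=
    inferInstanceAs (IsLocallyFiniteMeasure ((1 / (b * δ)).toNNReal • (volume : Measure ℝ)))
  exact MeasureTheory.Measure.isLocallyFiniteMeasure_of_le (logMeasure_restrict_Ioi_le hb hδ)

/-- `logMeasure b` is infinite on each neighbourhood of `0`, hence not outer regular there. On `(δ,
∞)` it is locally finite, so comparison on open sets suffices; then `δ` decreases to `0`. -/
lemma le_logMeasure_of_isOpen {b : ℝ} (hb : 0 < b) {μ : Measure ℝ} [IsProbabilityMeasure μ]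
    (h0 : μ (Iic 0) = 0) (hle : ∀ U : Set ℝ, IsOpen U → U ⊆ Ioi 0 → μ U ≤ logMeasure b U) :
    μ ≤ logMeasure b := by
  have hδ : ∀ δ : ℝ, 0 < δ → μ.restrict (Ioi δ) ≤ (logMeasure b).restrict (Ioi δ) := by
    intro δ hδ
    have := isLocallyFiniteMeasure_logMeasure_restrict_Ioi hb hδ
    refine measure_le_of_forall_isOpen fun U hU => ?_
    rw [Measure.restrict_apply hU.measurableSet, Measure.restrict_apply hU.measurableSet]
    exact hle _ (hU.inter isOpen_Ioi) fun x hx => hδ.trans hx.2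
  refine Measure.le_iff.2 fun s hs => ?_
  have hunion : (⋃ n : ℕ, Ioi (1 / ((n : ℝ) + 1))) = Ioi 0 := by
    ext x
    simp only [mem_iUnion, mem_Ioi]
    exact ⟨fun ⟨n, hn⟩ => lt_trans (by positivity) hn, fun hx => exists_nat_one_div_lt hx⟩
  have hmono : Monotone fun n : ℕ => s ∩ Ioi (1 / ((n : ℝ) + 1)) := by
    intro m n hmn
    refine inter_subset_inter_right _ (Ioi_subset_Ioi ?_)
    exact one_div_le_one_div_of_le (by positivity) (by exact_mod_cast Nat.succ_le_succ hmn)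
  calc μ s ≤ μ (s ∩ Ioi 0) + μ (Iic 0) := by
        refine (measure_mono fun x hx => ?_).trans (measure_union_le _ _)
        rcases le_or_gt x 0 with h | h
        exacts [Or.inr h, Or.inl ⟨hx, h⟩]
    _ = μ (s ∩ Ioi 0) := by rw [h0, add_zero]
    _ = ⨆ n : ℕ, μ (s ∩ Ioi (1 / ((n : ℝ) + 1))) := by
        rw [← hunion, inter_iUnion, hmono.measure_iUnion]
    _ ≤ logMeasure b s := by
        refine iSup_le fun n => ?_
        have := hδ (1 / ((n : ℝ) + 1)) (by positivity) s
        rw [Measure.restrict_apply hs, Measure.restrict_apply hs] at this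
        exact this.trans (measure_mono inter_subset_left)

/-! ### Images of measures under power maps -/

lemma rpow_rpow_one_div {x p : ℝ} (hx : 0 ≤ x) (hp : 0 < p) : (x ^ p) ^ (1 / p) = x := by
  rw [← Real.rpow_mul hx, mul_one_div_cancel hp.ne', Real.rpow_one]

lemma rpow_one_div_rpow {x p : ℝ} (hx : 0 ≤ x) (hp : 0 < p) : (x ^ (1 / p)) ^ p = x := by
  rw [← Real.rpow_mul hx, one_div_mul_cancel hp.ne', Real.rpow_one]

lemma measurable_rpow_const (p : ℝ) : Measurable fun x : ℝ => x ^ p := by fun_prop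

lemma map_rpow_withDensity {f : ℝ → ℝ≥0∞} {q : ℝ} (hq : 0 < q) :
    ((volume.restrict (Ioi 0)).withDensity f).map (fun x => x ^ (1 / q)) =
      (volume.restrict (Ioi 0)).withDensity
        fun x => ENNReal.ofReal (q * x ^ (q - 1)) * f (x ^ q) := by
  refine Measure.ext fun s hs => ?_
  have hT := measurable_rpow_const (1 / q)
  have himage : (fun x : ℝ => x ^ (1 / q)) ⁻¹' s ∩ Ioi 0 = (fun x : ℝ => x ^ q) '' (s ∩ Ioi 0) := by
    ext y
    constructor
    · rintro ⟨hy, hy0⟩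
      exact ⟨y ^ (1 / q), ⟨hy, Real.rpow_pos_of_pos hy0 _⟩, rpow_one_div_rpow (le_of_lt hy0) hq⟩
    · rintro ⟨x, ⟨hx, hx0⟩, rfl⟩
      refine ⟨?_, Real.rpow_pos_of_pos hx0 _⟩
      simpa only [mem_preimage, rpow_rpow_one_div (le_of_lt hx0) hq] using hx
  have hinj : InjOn (fun x : ℝ => x ^ q) (s ∩ Ioi 0) := by
    intro x hx y hy hxy
    exact (Real.rpow_left_inj (le_of_lt hx.2) (le_of_lt hy.2) hq.ne').1 hxy
  rw [Measure.map_apply hT hs, withDensity_apply _ (hT hs), withDensity_apply _ hs,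
    Measure.restrict_restrict (hT hs), Measure.restrict_restrict hs, himage,
    lintegral_image_eq_lintegral_abs_deriv_mul (hs.inter measurableSet_Ioi)
      (fun x hx => (Real.hasDerivAt_rpow_const (Or.inl (ne_of_gt hx.2))).hasDerivWithinAt) hinj]
  refine setLIntegral_congr_fun (hs.inter measurableSet_Ioi) fun x hx => ?_
  rw [abs_of_nonneg (mul_nonneg hq.le (Real.rpow_nonneg (le_of_lt hx.2) _))]

/-- With `y = x ^ p` one has `dy / y = p dx / x`. This is how the factor `ρ` enters the constraint
of the model problems. -/
lemma map_rpow_logMeasure {b p : ℝ} (hp : 0 < p) :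
    (logMeasure b).map (fun x => x ^ p) = logMeasure (b * p) := by
  have h := map_rpow_withDensity (f := fun x => ENNReal.ofReal (1 / (b * x))) (one_div_pos.2 hp)
  rw [one_div_one_div] at h
  rw [logMeasure, h, logMeasure]
  refine withDensity_congr_ae ?_
  filter_upwards [ae_restrict_mem measurableSet_Ioi] with x hx
  have hx : 0 < x := hx
  rw [← ENNReal.ofReal_mul (by positivity)]
  congr 1
  have := Real.rpow_pos_of_pos hx (1 / p)
  rw [Real.rpow_sub_one hx.ne']
  field_simp

lemma rpow_mem_Icc_iff {h x p : ℝ} (hh : 0 ≤ h) (hx : 0 ≤ x) (hp : 0 < p) :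
    x ^ p ∈ Icc 0 (h ^ p) ↔ x ∈ Icc 0 h := by
  simp only [mem_Icc, Real.rpow_nonneg hx, hx, true_and]
  exact Real.rpow_le_rpow_iff hx hh hp

lemma map_rpow_compl_Icc {h p : ℝ} (hh : 0 ≤ h) (hp : 0 < p) {μ : Measure ℝ}
    (hμ : μ (Icc 0 h)ᶜ = 0) : μ.map (fun x => x ^ p) (Icc 0 (h ^ p))ᶜ = 0 := by
  rw [Measure.map_apply (measurable_rpow_const p) measurableSet_Icc.compl]
  have hsub : (fun x : ℝ => x ^ p) ⁻¹' (Icc 0 (h ^ p))ᶜ ⊆ (Icc 0 h)ᶜ :=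
    fun x hx hx' => hx ((rpow_mem_Icc_iff hh hx'.1 hp).2 hx')
  exact measure_mono_null hsub hμ

lemma map_rpow_mem_constrainedMeasures {b h p : ℝ} (hh : 0 ≤ h) (hp : 0 < p) {μ : Measure ℝ}
    (hμ : μ ∈ constrainedMeasures b h) :
    μ.map (fun x => x ^ p) ∈ constrainedMeasures (b * p) (h ^ p) := by
  rw [mem_constrainedMeasures_iff] at hμ ⊢
  obtain ⟨hprob, hsupp, hle⟩ := hμ
  refine ⟨Measure.isProbabilityMeasure_map (measurable_rpow_const p).aemeasurable,
    map_rpow_compl_Icc hh hp hsupp, fun hb => ?_⟩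
  rw [← map_rpow_logMeasure hp]
  exact Measure.map_mono (hle (pos_of_mul_pos_left hb hp.le)) (measurable_rpow_const p)

lemma map_rpow_map_rpow_one_div {h p : ℝ} (hp : 0 < p) {μ : Measure ℝ}
    (hμ : μ (Icc 0 h)ᶜ = 0) :
    (μ.map (fun x => x ^ p)).map (fun x => x ^ (1 / p)) = μ := by
  rw [Measure.map_map (measurable_rpow_const _) (measurable_rpow_const _)]
  conv_rhs => rw [← Measure.map_id (μ := μ)]
  refine Measure.map_congr ?_
  have : ∀ᵐ x ∂μ, x ∈ Icc 0 h := hμ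
  filter_upwards [this] with x hx using rpow_rpow_one_div hx.1 hp

/-- Power maps are differentiable on `(0, ∞)`, so they send null sets to null sets; the origin is a
null set added by hand. Without an upper constraint a minimizer is not known to be absolutely
continuous, so the singular part has to be followed too. -/
lemma mutuallySingular_map_rpow {p : ℝ} (hp : 0 < p) {μ : Measure ℝ} (hμ : μ ⟂ₘ volume)
    (hneg : μ (Iio 0) = 0) : μ.map (fun x => x ^ p) ⟂ₘ volume := by
  obtain ⟨N, hN, hμN, hvol⟩ := hμ
  have hS := measurable_rpow_const (1 / p)
  have hms : MeasurableSet ((fun x : ℝ => x ^ (1 / p)) ⁻¹' Nᶜ ∩ Ioi 0 ∪ {0}) :=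
    ((hS hN.compl).inter measurableSet_Ioi).union (measurableSet_singleton 0)
  refine Measure.MutuallySingular.symm
    ⟨_, hms, measure_union_null ?_ Real.volume_singleton, ?_⟩
  · have himage : volume ((fun x : ℝ => x ^ p) '' (Nᶜ ∩ Ioi 0)) = 0 := by
      refine addHaar_image_eq_zero_of_differentiableOn_of_addHaar_eq_zero volume
        (fun x hx => ?_) (measure_mono_null inter_subset_left hvol)
      exact (Real.differentiableAt_rpow_const_of_ne p (ne_of_gt hx.2)).differentiableWithinAt
    refine measure_mono_null (fun x hx => ?_) himage
    exact ⟨x ^ (1 / p), ⟨hx.1, Real.rpow_pos_of_pos hx.2 _⟩, rpow_one_div_rpow (le_of_lt hx.2) hp⟩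
  · rw [Measure.map_apply (measurable_rpow_const p) hms.compl]
    refine measure_mono_null (fun x hx => ?_) (measure_union_null hμN hneg)
    rcases lt_or_ge x 0 with hx0 | hx0
    · exact Or.inr hx0
    left
    by_contra hxN
    refine hx ?_
    rcases hx0.eq_or_lt with rfl | hx0
    · exact Or.inr (by simp [Real.zero_rpow hp.ne'])
    · refine Or.inl ⟨?_, Real.rpow_pos_of_pos hx0 _⟩
      simpa only [mem_preimage, rpow_rpow_one_div hx0.le hp, mem_compl_iff] using hxN

/-- The image of the singular part is singular and the image of the continuous part has the claimed
density, so uniqueness of the Lebesgue decomposition identifies the derivative. -/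
lemma isPowerPushforward_map {ζ h : ℝ} (hζ : 0 < ζ) {ω : Measure ℝ} [IsProbabilityMeasure ω]
    (hω : ω (Icc 0 h)ᶜ = 0) : IsPowerPushforward ζ ω (ω.map fun y => y ^ (1 / ζ)) := by
  refine ⟨rfl, ?_⟩
  have hneg : ω (Iio 0) = 0 :=
    measure_mono_null (fun x (hx : x < 0) (hx' : x ∈ Icc 0 h) => hx.not_ge hx'.1) hω
  have hdens : volume.withDensity (ω.rnDeriv volume) =
      (volume.restrict (Ioi 0)).withDensity (ω.rnDeriv volume) := by
    rw [← restrict_withDensity measurableSet_Ioi, Measure.restrict_eq_self_of_ae_mem]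
    have h0 : volume.withDensity (ω.rnDeriv volume) (Iic 0) = 0 := by
      rw [← Iio_union_right]
      refine measure_union_null ?_ (withDensity_absolutelyContinuous _ _ (by simp))
      exact le_antisymm ((Measure.withDensity_rnDeriv_le ω volume _).trans hneg.le) zero_le
    rwa [← compl_Ioi] at h0
  set g : ℝ → ℝ≥0∞ := fun x =>
    ENNReal.ofReal (ζ * x ^ (ζ - 1)) * ω.rnDeriv volume (x ^ ζ) with hg
  have hgm : Measurable g := by
    refine Measurable.mul (by fun_prop) ?_
    exact (Measure.measurable_rnDeriv _ _).comp (measurable_rpow_const ζ)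
  have hdecomp : ω.map (fun y => y ^ (1 / ζ)) =
      (ω.singularPart volume).map (fun y => y ^ (1 / ζ)) +
        volume.withDensity ((Ioi 0).indicator g) := by
    conv_lhs => rw [← Measure.singularPart_add_rnDeriv ω volume]
    rw [Measure.map_add _ _ (measurable_rpow_const _), hdens, map_rpow_withDensity hζ,
      withDensity_indicator measurableSet_Ioi]
  have hsing := mutuallySingular_map_rpow (one_div_pos.2 hζ)
    (Measure.mutuallySingular_singularPart ω volume)
    (le_antisymm ((Measure.singularPart_le ω volume _).trans hneg.le) zero_le)
  filter_upwards [Measure.eq_rnDeriv (hgm.indicator measurableSet_Ioi) hsing hdecomp] with x hx hx0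
  rw [← hx, indicator_of_mem (show x ∈ Ioi 0 from hx0)]

/-! ### Finiteness of the energy -/

/-- By Tonelli: each `x` lies in `(t, t + r)` for a set of `t` of length `r`. -/
lemma lintegral_measure_interval (μ : Measure ℝ) [IsProbabilityMeasure μ] (r : ℝ) :
    ∫⁻ t, μ (Ioo t (t + r)) = ENNReal.ofReal r := by
  have hms : MeasurableSet {q : ℝ × ℝ | q.2 ∈ Ioo q.1 (q.1 + r)} :=
    (measurableSet_lt measurable_fst measurable_snd).inter
      (measurableSet_lt measurable_snd (by fun_prop))
  calc ∫⁻ t, μ (Ioo t (t + r))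
      = (volume.prod μ) {q : ℝ × ℝ | q.2 ∈ Ioo q.1 (q.1 + r)} := (Measure.prod_apply hms).symm
    _ = ∫⁻ x, volume (Ioo (x - r) x) ∂μ := by
        rw [Measure.prod_apply_symm hms]
        refine lintegral_congr fun x => congrArg _ ?_
        ext t
        simp only [mem_preimage, mem_ofPred_eq, mem_Ioo]
        constructor <;> rintro ⟨h1, h2⟩ <;> constructor <;> linarith
    _ = ENNReal.ofReal r := by simp

/-- One factor `μ (t, t + r)` is at most `D r`, the other integrates to `r` over `t`, and together
they cancel the weight `r⁻²`. -/
lemma mutualEnergy_self_ne_top {μ : Measure ℝ} [IsProbabilityMeasure μ] {D : ℝ}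
    (hD : μ ≤ ENNReal.ofReal D • volume) : mutualEnergy μ μ ≠ ⊤ := by
  have hms := measurable_measure_interval μ
  have hle : ∀ r t : ℝ, μ (Ioo t (t + r)) ≤ ENNReal.ofReal D * ENNReal.ofReal r := by
    intro r t
    refine (hD _).trans ?_
    simp
  rw [mutualEnergy, lintegral_kernelMeasure (by exact hms.mul hms)]
  refine ENNReal.add_ne_top.2 ⟨?_, ?_⟩
  · refine ne_top_of_le_ne_top (b := ENNReal.ofReal D) ENNReal.ofReal_ne_top ?_
    calc ∫⁻ r in Ioc 0 1, ENNReal.ofReal (1 / r ^ 2) *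
          ∫⁻ t, μ (Ioo t (t + r)) * μ (Ioo t (t + r))
        ≤ ∫⁻ r in Ioc (0 : ℝ) 1, ENNReal.ofReal D := by
          refine setLIntegral_mono measurable_const fun r hr => ?_
          have hr0 : 0 < r := hr.1
          calc ENNReal.ofReal (1 / r ^ 2) * ∫⁻ t, μ (Ioo t (t + r)) * μ (Ioo t (t + r))
              ≤ ENNReal.ofReal (1 / r ^ 2) *
                  ∫⁻ t, ENNReal.ofReal D * ENNReal.ofReal r * μ (Ioo t (t + r)) := by
                gcongr
                exact hle r _
            _ = ENNReal.ofReal (1 / r ^ 2) *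
                  (ENNReal.ofReal D * ENNReal.ofReal r * ENNReal.ofReal r) := by
                rw [lintegral_const_mul' _ _ (by finiteness), lintegral_measure_interval]
            _ = ENNReal.ofReal D * ENNReal.ofReal (1 / r ^ 2 * r * r) := by
                rw [ENNReal.ofReal_mul (by positivity), ENNReal.ofReal_mul (by positivity)]
                ring
            _ = ENNReal.ofReal D := by
                rw [show 1 / r ^ 2 * r * r = 1 by field_simp]
                simp
      _ = ENNReal.ofReal D := by simp
  · refine ne_top_of_le_ne_top (b := ENNReal.ofReal 1) ENNReal.ofReal_ne_top ?_
    rw [← lintegral_measure_interval μ 1]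
    exact lintegral_mono fun t => mul_le_of_le_one_left zero_le prob_le_one

/-! ### Equilibrium problems with two logarithmic interactions -/

/-- The energy of `ω` for the interactions `-ln |x ^ ν - y ^ ν|` and `-ln |x - y|` and the external
field `V`. -/
noncomputable def fieldEnergy (ν : ℝ) (V : ℝ → ℝ≥0∞) (ω : Measure ℝ) : ℝ≥0∞ :=
  ENNReal.ofReal (1 / 2) * ∫⁻ x, ∫⁻ y, (negLog |x ^ ν - y ^ ν| + negLog |x - y|) ∂ω ∂ω
    + ∫⁻ x, V x ∂ω

lemma compl_Icc_zero_one_null {h : ℝ} (hh : h ≤ 1) {μ : Measure ℝ} (hμ : μ (Icc 0 h)ᶜ = 0) :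
    μ (Icc 0 1)ᶜ = 0 :=
  measure_mono_null (compl_subset_compl.2 (Icc_subset_Icc_right hh)) hμ

lemma map_rpow_compl_Icc_zero_one {p : ℝ} (hp : 0 < p) {μ : Measure ℝ} (hμ : μ (Icc 0 1)ᶜ = 0) :
    μ.map (fun x => x ^ p) (Icc 0 1)ᶜ = 0 := by
  simpa using map_rpow_compl_Icc zero_le_one hp hμ

lemma lintegral_interaction_eq {ν : ℝ} (hν : 0 < ν) {μ : Measure ℝ} [SFinite μ]
    (hμ : μ (Icc 0 1)ᶜ = 0) :
    ∫⁻ x, ∫⁻ y, (negLog |x ^ ν - y ^ ν| + negLog |x - y|) ∂μ ∂μ =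
      mutualEnergy (μ.map fun x => x ^ ν) (μ.map fun x => x ^ ν) + mutualEnergy μ μ := by
  have hT := measurable_rpow_const ν
  have hm1 : Measurable fun q : ℝ × ℝ => negLog |q.1 - q.2| := by fun_prop
  have hm2 : Measurable fun q : ℝ × ℝ => negLog |q.1 ^ ν - q.2 ^ ν| := by fun_prop
  have hinner : ∀ x, ∫⁻ y, (negLog |x ^ ν - y ^ ν| + negLog |x - y|) ∂μ =
      ∫⁻ y, negLog |x ^ ν - y ^ ν| ∂μ + ∫⁻ y, negLog |x - y| ∂μ := fun x =>
    lintegral_add_left (by fun_prop) _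
  have hsupp := map_rpow_compl_Icc_zero_one hν hμ
  simp_rw [hinner]
  rw [lintegral_add_left hm2.lintegral_prod_right', lintegral_negLog_eq_mutualEnergy hμ hμ,
    ← lintegral_negLog_eq_mutualEnergy hsupp hsupp, lintegral_map hm1.lintegral_prod_right' hT]
  congr 1
  refine lintegral_congr fun x => ?_
  rw [lintegral_map (by fun_prop) hT]

lemma fieldEnergy_eq {ν : ℝ} (hν : 0 < ν) (V : ℝ → ℝ≥0∞) {μ : Measure ℝ} [SFinite μ]
    (hμ : μ (Icc 0 1)ᶜ = 0) :
    fieldEnergy ν V μ = ENNReal.ofReal (1 / 2) *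
      (mutualEnergy (μ.map fun x => x ^ ν) (μ.map fun x => x ^ ν) + mutualEnergy μ μ)
        + ∫⁻ x, V x ∂μ := by
  rw [fieldEnergy, lintegral_interaction_eq hν hμ]

lemma ne_top_of_mul_ne_top {a b : ℝ≥0∞} (h : a * b ≠ ⊤) (ha : a ≠ 0) : b ≠ ⊤ := fun hb =>
  h (by rw [hb, ENNReal.mul_top ha])

/-! ### Uniqueness -/

lemma mutualEnergy_midpoint (μ μ' : Measure ℝ) [SFinite μ] [SFinite μ'] :
    mutualEnergy ((2⁻¹ : ℝ≥0∞) • (μ + μ')) ((2⁻¹ : ℝ≥0∞) • (μ + μ')) =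
      4⁻¹ * (mutualEnergy μ μ + mutualEnergy μ' μ' + 2 * mutualEnergy μ μ') := by
  have h := measurable_measure_interval μ
  have h' := measurable_measure_interval μ'
  unfold mutualEnergy
  rw [← lintegral_const_mul 2 (by exact h.mul h'), ← lintegral_add_left (by exact h.mul h),
    ← lintegral_add_left (by exact (h.mul h).add (h'.mul h')),
    ← lintegral_const_mul' _ _ (by simp)]
  refine lintegral_congr fun p => ?_
  have h4 : (4 : ℝ≥0∞)⁻¹ = 2⁻¹ * 2⁻¹ := by
    rw [← ENNReal.mul_inv (by simp) (by simp)]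
    norm_num
  rw [h4, Measure.smul_apply, Measure.add_apply, smul_eq_mul]
  ring

lemma midpoint_mem_constrainedMeasures {b h : ℝ} {μ μ' : Measure ℝ}
    (hμ : μ ∈ constrainedMeasures b h) (hμ' : μ' ∈ constrainedMeasures b h) :
    (2⁻¹ : ℝ≥0∞) • (μ + μ') ∈ constrainedMeasures b h := by
  rw [mem_constrainedMeasures_iff] at hμ hμ' ⊢
  obtain ⟨h1, h2, h3⟩ := hμ
  obtain ⟨h1', h2', h3'⟩ := hμ'
  have h22 : (2⁻¹ : ℝ≥0∞) * 2 = 1 := ENNReal.inv_mul_cancel (by simp) (by simp)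
  refine ⟨⟨?_⟩, by simp [h2, h2'], fun hb => Measure.le_iff.2 fun s _ => ?_⟩
  · rw [Measure.smul_apply, Measure.add_apply, measure_univ, measure_univ, smul_eq_mul,
      one_add_one_eq_two, h22]
  · rw [Measure.smul_apply, Measure.add_apply, smul_eq_mul]
    calc 2⁻¹ * (μ s + μ' s) ≤ 2⁻¹ * (logMeasure b s + logMeasure b s) := by
          gcongr
          exacts [h3 hb, h3' hb]
      _ = logMeasure b s := by rw [← two_mul, ← mul_assoc, h22, one_mul]

/-- The midpoint of two minimizers costs at least as much as either. The field is affine and both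
interactions are convex, so the convexity inequality for `-ln |x - y|` is an equality, and
`eq_of_mutualEnergy_le` applies. -/
lemma isUniqueMinimizer_of_forall_le {b h ν : ℝ} (hν : 0 < ν) (hh : h ≤ 1) {V : ℝ → ℝ≥0∞}
    {ω : Measure ℝ} (hω : ω ∈ constrainedMeasures b h) (hfin : fieldEnergy ν V ω ≠ ⊤)
    (hmin : ∀ ω' ∈ constrainedMeasures b h, fieldEnergy ν V ω ≤ fieldEnergy ν V ω') :
    IsUniqueMinimizer (constrainedMeasures b h) (fieldEnergy ν V) ω := by
  refine ⟨hω, fun ω' hω' hne => ?_⟩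
  by_contra! hle
  refine hne ?_
  have hmid := midpoint_mem_constrainedMeasures hω hω'
  have h1 := hmin _ hmid
  have h2 := hle.trans h1
  have hfin' : fieldEnergy ν V ω' ≠ ⊤ := ne_top_of_le_ne_top hfin hle
  have : IsProbabilityMeasure ω := hω.1
  have : IsProbabilityMeasure ω' := hω'.1
  have : IsProbabilityMeasure ((2⁻¹ : ℝ≥0∞) • (ω + ω')) := hmid.1
  have hs := compl_Icc_zero_one_null hh hω.2.1
  have hs' := compl_Icc_zero_one_null hh hω'.2.1
  rw [fieldEnergy_eq hν V (compl_Icc_zero_one_null hh hmid.2.1), Measure.map_smul,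
    Measure.map_add _ _ (measurable_rpow_const ν), mutualEnergy_midpoint, mutualEnergy_midpoint,
    lintegral_smul_measure, lintegral_add_measure, smul_eq_mul] at h1 h2
  rw [fieldEnergy_eq hν V hs] at hfin h1
  rw [fieldEnergy_eq hν V hs'] at hfin' h2
  have hE := two_mul_mutualEnergy_le (ω.map fun x => x ^ ν) (ω'.map fun x => x ^ ν)
  have hE' := two_mul_mutualEnergy_le ω ω'
  have hhalf : ENNReal.ofReal (1 / 2) ≠ 0 := by simp
  have hf := ENNReal.add_ne_top.1 hfin
  have hf' := ENNReal.add_ne_top.1 hfin'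
  have hJ := ENNReal.add_ne_top.1 (ne_top_of_mul_ne_top hf.1 hhalf)
  have hJ' := ENNReal.add_ne_top.1 (ne_top_of_mul_ne_top hf'.1 hhalf)
  refine (eq_of_mutualEnergy_le hs hs' hJ.2 hJ'.2 ?_).symm
  have hX := ne_top_of_mul_ne_top
    (ne_top_of_le_ne_top (ENNReal.add_ne_top.2 ⟨hJ.1, hJ'.1⟩) hE) two_ne_zero
  have hX' := ne_top_of_mul_ne_top
    (ne_top_of_le_ne_top (ENNReal.add_ne_top.2 ⟨hJ.2, hJ'.2⟩) hE') two_ne_zero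
  obtain ⟨hJ1, hJ2⟩ := hJ
  obtain ⟨hJ1', hJ2'⟩ := hJ'
  obtain ⟨-, hV⟩ := hf
  obtain ⟨-, hV'⟩ := hf'
  clear hfin hfin' hle hmin hne hmid hω hω'
  -- All quantities are finite by now; they are moved to `ℝ` because the final comparison cancels
  -- terms.
  have h2c : (2⁻¹ : ℝ≥0∞) = ((2⁻¹ : NNReal) : ℝ≥0∞) := by simp
  have h4c : (4⁻¹ : ℝ≥0∞) = ((4⁻¹ : NNReal) : ℝ≥0∞) := by simp
  have h12 : ENNReal.ofReal (1 / 2) = ((2⁻¹ : NNReal) : ℝ≥0∞) := by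
    rw [one_div, ENNReal.ofReal_inv_of_pos two_pos]
    simp
  rw [h12, h2c, h4c] at h1 h2
  generalize mutualEnergy (ω.map fun x => x ^ ν) (ω.map fun x => x ^ ν) = a₁ at *
  generalize mutualEnergy (ω'.map fun x => x ^ ν) (ω'.map fun x => x ^ ν) = a₂ at *
  generalize mutualEnergy (ω.map fun x => x ^ ν) (ω'.map fun x => x ^ ν) = a₃ at *
  generalize mutualEnergy ω ω = b₁ at *
  generalize mutualEnergy ω' ω' = b₂ at *
  generalize mutualEnergy ω ω' = b₃ at *
  generalize ∫⁻ x, V x ∂ω = v₁ at *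
  generalize ∫⁻ x, V x ∂ω' = v₂ at *
  lift a₁ to NNReal using hJ1
  lift a₂ to NNReal using hJ1'
  lift a₃ to NNReal using hX
  lift b₁ to NNReal using hJ2
  lift b₂ to NNReal using hJ2'
  lift b₃ to NNReal using hX'
  lift v₁ to NNReal using hV
  lift v₂ to NNReal using hV'
  norm_cast at h1 h2 hE hE' ⊢
  rw [← NNReal.coe_le_coe] at h1 h2 hE hE' ⊢
  push_cast at h1 h2 hE hE' ⊢
  linarith

/-! ### Existence -/

/-- The weak closure of the constraints: no condition on the mass at the origin. -/
def relaxedConstraint (b h : ℝ) : Set (ProbabilityMeasure ℝ) :=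
  {μ | (μ : Measure ℝ) (Icc 0 h)ᶜ = 0 ∧
    (0 < b → ∀ U : Set ℝ, IsOpen U → U ⊆ Ioi 0 → (μ : Measure ℝ) U ≤ logMeasure b U)}

/-- Measures carried by a fixed compact set form a weakly compact set, and upper bounds on open sets
are weakly closed conditions. -/
lemma isCompact_relaxedConstraint (b h : ℝ) : IsCompact (relaxedConstraint b h) := by
  have hK := isCompact_setOfPred_probabilityMeasure_mass_eq_compl_isCompact_le (E := ℝ)
    (u := fun _ => 0) (K := fun _ => Icc 0 h) tendsto_const_nhds (fun _ => isCompact_Icc)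
    (Or.inl inferInstance)
  have hK' : {μ : ProbabilityMeasure ℝ | ∀ _ : ℕ, μ (Icc 0 h)ᶜ ≤ 0} =
      {μ : ProbabilityMeasure ℝ | (μ : Measure ℝ) (Icc 0 h)ᶜ = 0} := by
    ext μ
    simp [ProbabilityMeasure.null_iff_toMeasure_null]
  rw [hK'] at hK
  have hclosed : IsClosed {μ : ProbabilityMeasure ℝ | 0 < b → ∀ U : Set ℝ, IsOpen U →
      U ⊆ Ioi 0 → (μ : Measure ℝ) U ≤ logMeasure b U} := by
    simp only [ofPred_forall]
    exact isClosed_iInter fun _ => isClosed_iInter fun U => isClosed_iInter fun hU =>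
      isClosed_iInter fun _ =>
        (lowerSemicontinuous_measure_of_isOpen hU).isClosed_preimage (logMeasure b U)
  exact hK.inter_right hclosed

lemma mem_relaxedConstraint_of_mem {b h : ℝ} {μ : ProbabilityMeasure ℝ}
    (hμ : (μ : Measure ℝ) ∈ constrainedMeasures b h) : μ ∈ relaxedConstraint b h := by
  rw [mem_constrainedMeasures_iff] at hμ
  exact ⟨hμ.2.1, fun hb U _ _ => hμ.2.2 hb U⟩

/-- An atom at `a` would contribute `μ {a} ^ 2 * ∞`, from the diagonal point `(a, a)`. -/
lemma measure_singleton_eq_zero_of_lintegral_negLog_ne_top {μ : Measure ℝ}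
    (hμ : ∫⁻ x, ∫⁻ y, negLog |x - y| ∂μ ∂μ ≠ ⊤) (a : ℝ) : μ {a} = 0 := by
  by_contra h0
  refine hμ (eq_top_iff.2 ?_)
  have hinner : ∫⁻ y, negLog |a - y| ∂μ = ⊤ := by
    refine eq_top_iff.2 (le_trans ?_ (setLIntegral_le_lintegral {a} _))
    simp [negLog_zero, ENNReal.mul_top h0]
  refine le_trans ?_ (setLIntegral_le_lintegral {a} _)
  simp [hinner, ENNReal.mul_top h0]

lemma mem_of_mem_relaxedConstraint {b h ν : ℝ} (hν : 0 < ν) (hh : h ≤ 1) {V : ℝ → ℝ≥0∞}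
    {μ : ProbabilityMeasure ℝ} (hμ : μ ∈ relaxedConstraint b h)
    (hfin : fieldEnergy ν V μ ≠ ⊤) : (μ : Measure ℝ) ∈ constrainedMeasures b h := by
  rw [mem_constrainedMeasures_iff]
  refine ⟨inferInstance, hμ.1, fun hb => le_logMeasure_of_isOpen hb ?_ (hμ.2 hb)⟩
  have hs := compl_Icc_zero_one_null hh hμ.1
  rw [fieldEnergy_eq hν V hs] at hfin
  have hE := (ENNReal.add_ne_top.1 (ne_top_of_mul_ne_top
    (ENNReal.add_ne_top.1 hfin).1 (by simp))).2
  rw [← lintegral_negLog_eq_mutualEnergy hs hs] at hE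
  refine measure_mono_null (t := {0} ∪ (Icc 0 1)ᶜ) (fun x hx => ?_) (measure_union_null
    (measure_singleton_eq_zero_of_lintegral_negLog_ne_top hE 0) hs)
  simp only [mem_Iic, mem_union, mem_singleton_iff, mem_compl_iff, mem_Icc] at hx ⊢
  grind

lemma lowerSemicontinuous_energy {ν : ℝ} (hν : 0 < ν) {V : ℝ → ℝ≥0∞}
    (hV : LowerSemicontinuous V) :
    LowerSemicontinuous fun μ : ProbabilityMeasure ℝ => ENNReal.ofReal (1 / 2) *
      (mutualEnergy ((μ : Measure ℝ).map fun x => x ^ ν) ((μ : Measure ℝ).map fun x => x ^ ν)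
        + mutualEnergy (μ : Measure ℝ) μ) + ∫⁻ x, V x ∂(μ : Measure ℝ) := by
  have h1 := lowerSemicontinuous_mutualEnergy_self (Real.continuous_rpow_const hν.le)
  have h2 := lowerSemicontinuous_mutualEnergy_self continuous_id
  simp only [Measure.map_id] at h2
  exact (LowerSemicontinuous.const_mul_ennreal (h1.add h2) ENNReal.ofReal_ne_top).add
    (lowerSemicontinuous_lintegral_measure hV)

lemma exists_mem_constrainedMeasures_fieldEnergy_ne_top {b h ν : ℝ} (hν : 0 < ν) (hh : 0 < h)
    (hh1 : h ≤ 1) {V : ℝ → ℝ≥0∞}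
    (hbdd : ∀ a > 0, ∃ M : ℝ≥0∞, M ≠ ⊤ ∧ ∀ x ∈ Ioc a (h / 2), V x ≤ M) :
    ∃ ω ∈ constrainedMeasures b h, fieldEnergy ν V ω ≠ ⊤ := by
  -- The maximum with `1` keeps the test density `1 / (B x)` meaningful when `b = 0`.
  set B : ℝ := max b 1 with hB
  have hB0 : 0 < B := lt_max_of_lt_right one_pos
  -- With this choice `dx / (B x)` has mass `ln ((h / 2) / a) / B = 1` on `(a, h / 2]`, an interval
  -- that avoids `0` and `h`, where the field may be infinite.
  set a : ℝ := h / 2 * Real.exp (-B) with ha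
  have ha0 : 0 < a := by positivity
  have hah : a ≤ h / 2 :=
    mul_le_of_le_one_right (by positivity) (Real.exp_le_one_iff.2 (by linarith))
  set ω := (logMeasure B).restrict (Ioc a (h / 2)) with hω
  have hmass : ω univ = 1 := by
    rw [hω, Measure.restrict_apply_univ, logMeasure_apply _ measurableSet_Ioc,
      inter_eq_left.2 (show Ioc a (h / 2) ⊆ Ioi 0 from fun x hx => ha0.trans hx.1)]
    have hcont : ContinuousOn (fun x : ℝ => 1 / (B * x)) (uIcc a (h / 2)) := by
      rw [uIcc_of_le hah]
      refine ContinuousOn.div (by fun_prop) (by fun_prop) fun x hx => ?_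
      have := ha0.trans_le hx.1
      positivity
    rw [← ofReal_integral_eq_lintegral_ofReal, ← intervalIntegral.integral_of_le hah]
    · simp_rw [one_div, mul_inv]
      rw [intervalIntegral.integral_const_mul, integral_inv_of_pos ha0 (by positivity), ha,
        div_mul_cancel_left₀ (by positivity), ← Real.exp_neg, Real.log_exp, neg_neg,
        inv_mul_cancel₀ hB0.ne', ENNReal.ofReal_one]
    · exact (intervalIntegrable_iff_integrableOn_Ioc_of_le hah).1 hcont.intervalIntegrable
    · refine (ae_restrict_mem measurableSet_Ioc).mono fun x hx => ?_
      have := ha0.trans hx.1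
      positivity
  have hprob : IsProbabilityMeasure ω := ⟨hmass⟩
  have hsupp : ω (Icc 0 h)ᶜ = 0 := by
    rw [hω, Measure.restrict_apply measurableSet_Icc.compl]
    convert measure_empty (μ := logMeasure B)
    ext x
    simp only [mem_inter_iff, mem_compl_iff, mem_Icc, mem_Ioc, mem_empty_iff_false]
    grind
  refine ⟨ω, mem_constrainedMeasures_iff.2 ⟨hprob, hsupp, fun hb => ?_⟩, ?_⟩
  · refine Measure.restrict_le_self.trans (withDensity_mono ?_)
    filter_upwards [ae_restrict_mem measurableSet_Ioi] with x hx
    have hx : 0 < x := hx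
    have hbB : b ≤ B := le_max_left _ _
    gcongr
  rw [fieldEnergy_eq hν V (compl_Icc_zero_one_null hh1 hsupp)]
  have hmapprob : IsProbabilityMeasure (ω.map fun x => x ^ ν) :=
    Measure.isProbabilityMeasure_map (measurable_rpow_const ν).aemeasurable
  have hle : ω ≤ ENNReal.ofReal (1 / (B * a)) • volume :=
    (Measure.restrict_mono_set _ Ioc_subset_Ioi_self).trans (logMeasure_restrict_Ioi_le hB0 ha0)
  have hmaple : (ω.map fun x => x ^ ν) ≤ ENNReal.ofReal (1 / (B * ν * a ^ ν)) • volume := by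
    refine le_trans (Measure.le_iff.2 fun s hs => ?_)
      (logMeasure_restrict_Ioi_le (mul_pos hB0 hν) (Real.rpow_pos_of_pos ha0 ν))
    have hT := measurable_rpow_const ν
    rw [Measure.map_apply hT hs, hω, Measure.restrict_apply (hT hs), Measure.restrict_apply hs,
      ← map_rpow_logMeasure hν, Measure.map_apply hT (hs.inter measurableSet_Ioi)]
    exact measure_mono fun x hx => ⟨hx.1, Real.rpow_lt_rpow ha0.le hx.2.1 hν⟩
  refine ENNReal.add_ne_top.2 ⟨ENNReal.mul_ne_top ENNReal.ofReal_ne_top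
    (ENNReal.add_ne_top.2 ⟨mutualEnergy_self_ne_top hmaple, mutualEnergy_self_ne_top hle⟩), ?_⟩
  obtain ⟨M, hM, hVM⟩ := hbdd a ha0
  refine ne_top_of_le_ne_top hM ?_
  calc ∫⁻ x, V x ∂ω ≤ ∫⁻ _, M ∂ω :=
        lintegral_mono_ae ((ae_restrict_mem measurableSet_Ioc).mono hVM)
    _ = M := by simp

/-- Existence and uniqueness for the equilibrium problem with upper constraint `1 / (b x)`. -/
theorem exists_isUniqueMinimizer {b h ν : ℝ} (hν : 0 < ν) (hh : 0 < h)
    (hh1 : h ≤ 1) {V : ℝ → ℝ≥0∞} (hV : LowerSemicontinuous V)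
    (hbdd : ∀ a > 0, ∃ M : ℝ≥0∞, M ≠ ⊤ ∧ ∀ x ∈ Ioc a (h / 2), V x ≤ M) :
    ∃ ω, IsUniqueMinimizer (constrainedMeasures b h) (fieldEnergy ν V) ω := by
  obtain ⟨ω₀, hω₀, hfin₀⟩ :=
    exists_mem_constrainedMeasures_fieldEnergy_ne_top (b := b) hν hh hh1 hbdd
  have hmem : ∀ ω, ∀ hω : ω ∈ constrainedMeasures b h,
      (⟨ω, hω.1⟩ : ProbabilityMeasure ℝ) ∈ relaxedConstraint b h := fun ω hω =>
    mem_relaxedConstraint_of_mem hω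
  -- The minimum is taken over the compact relaxed set; finiteness of the energy then puts the
  -- minimizer back in the original set.
  obtain ⟨μ, hμ, hmin⟩ := LowerSemicontinuousOn.exists_isMinOn (s := relaxedConstraint b h) ⟨_, hmem ω₀ hω₀⟩
      (isCompact_relaxedConstraint b h)
      ((lowerSemicontinuous_energy hν hV).lowerSemicontinuousOn _)
  have hle : ∀ ω ∈ constrainedMeasures b h, fieldEnergy ν V μ ≤ fieldEnergy ν V ω := by
    intro ω hω
    have : IsProbabilityMeasure ω := hω.1
    rw [fieldEnergy_eq hν V (compl_Icc_zero_one_null hh1 hμ.1),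
      fieldEnergy_eq hν V (compl_Icc_zero_one_null hh1 hω.2.1)]
    exact hmin (hmem ω hω)
  have hfin : fieldEnergy ν V μ ≠ ⊤ := ne_top_of_le_ne_top hfin₀ (hle ω₀ hω₀)
  exact ⟨μ, isUniqueMinimizer_of_forall_le hν hh1
    (mem_of_mem_relaxedConstraint hν hh1 hμ hfin) hfin hle⟩

/-! ### The external field of the model problems -/

/-- The external field `-c ∫ ln (1 - x ^ σ e ^ (-k u)) du - m ln x`. -/
noncomputable def modelField (σ c n₁ n₂ k m x : ℝ) : ℝ≥0∞ :=
  ENNReal.ofReal c * (∫⁻ u in Ioc n₁ n₂, negLog (1 - x ^ σ * Real.exp (-(k * u))))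
    + ENNReal.ofReal m * negLog x

lemma lowerSemicontinuous_modelField {σ : ℝ} (hσ : 0 < σ) (c n₁ n₂ k m : ℝ) :
    LowerSemicontinuous (modelField σ c n₁ n₂ k m) := by
  refine LowerSemicontinuous.add (LowerSemicontinuous.const_mul_ennreal
    (lowerSemicontinuous_lintegral (fun x => by fun_prop) fun u => ?_) ENNReal.ofReal_ne_top)
    (LowerSemicontinuous.const_mul_ennreal lowerSemicontinuous_negLog ENNReal.ofReal_ne_top)
  have hcont : Continuous fun x : ℝ => 1 - x ^ σ * Real.exp (-(k * u)) :=
    continuous_const.sub ((Real.continuous_rpow_const hσ.le).mul continuous_const)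
  exact lowerSemicontinuous_negLog.comp hcont

/-- The worst `u` is `n₁`. There `hn` says that `1 - x ^ σ e ^ (-k u)` has no zero before `h`, so
for `x ≤ h / 2` it is at least `1 - 2 ^ (-σ)`. -/
lemma modelField_bounded {σ c n₁ n₂ k m h : ℝ} (hσ : 0 < σ) (hk : 0 ≤ k) (hh : 0 < h)
    (hn : h ^ σ * Real.exp (-(k * n₁)) ≤ 1) {a : ℝ} (ha : 0 < a) :
    ∃ M : ℝ≥0∞, M ≠ ⊤ ∧ ∀ x ∈ Ioc a (h / 2), modelField σ c n₁ n₂ k m x ≤ M := by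
  have hlt : (1 / 2 : ℝ) ^ σ < 1 := Real.rpow_lt_one (by norm_num) (by norm_num) hσ
  refine ⟨ENNReal.ofReal c * (negLog (1 - (1 / 2) ^ σ) * volume (Ioc n₁ n₂))
    + ENNReal.ofReal m * negLog a, ?_, fun x hx => ?_⟩
  · rw [negLog_of_pos (by linarith), negLog_of_pos ha, Real.volume_Ioc]
    finiteness
  · have hx0 : 0 < x := ha.trans hx.1
    refine add_le_add ?_ (by gcongr; exact antitone_negLog hx.1.le)
    gcongr
    rw [← setLIntegral_const]
    refine setLIntegral_mono measurable_const fun u hu => antitone_negLog ?_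
    have h1 : x ^ σ * Real.exp (-(k * u)) ≤ (1 / 2) ^ σ := by
      calc x ^ σ * Real.exp (-(k * u)) ≤ (h * (1 / 2)) ^ σ * Real.exp (-(k * n₁)) := by
            have hx2 : x ≤ h * (1 / 2) := by linarith [hx.2]
            have hu' : n₁ ≤ u := hu.1.le
            gcongr
        _ = (h ^ σ * Real.exp (-(k * n₁))) * (1 / 2) ^ σ := by
            rw [Real.mul_rpow hh.le (by norm_num)]
            ring
        _ ≤ 1 * (1 / 2) ^ σ := by gcongr
        _ = (1 / 2) ^ σ := one_mul _
    linarith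

lemma lintegral_modelField (σ c n₁ n₂ k m : ℝ) (μ : Measure ℝ) :
    ∫⁻ x, modelField σ c n₁ n₂ k m x ∂μ =
      ENNReal.ofReal c * ∫⁻ x, (∫⁻ u in Ioc n₁ n₂, negLog (1 - x ^ σ * Real.exp (-(k * u)))) ∂μ
        + ENNReal.ofReal m * ∫⁻ x, negLog x ∂μ := by
  simp only [modelField]
  rw [lintegral_add_right _ (by fun_prop), lintegral_const_mul' _ _ ENNReal.ofReal_ne_top,
    lintegral_const_mul' _ _ ENNReal.ofReal_ne_top]

lemma fieldEnergy_map_rpow {ζ ν σ : ℝ} (hζ : 0 < ζ) (c n₁ n₂ k m : ℝ) {μ : Measure ℝ}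
    [SFinite μ] (hμ : μ (Icc 0 1)ᶜ = 0) :
    fieldEnergy ν (modelField σ c n₁ n₂ k m) (μ.map fun x => x ^ ζ) =
      ENNReal.ofReal (1 / 2) *
        ∫⁻ x, ∫⁻ y, (negLog |x ^ (ζ * ν) - y ^ (ζ * ν)| + negLog |x ^ ζ - y ^ ζ|) ∂μ ∂μ
      + (ENNReal.ofReal c *
          ∫⁻ x, (∫⁻ u in Ioc n₁ n₂, negLog (1 - x ^ (ζ * σ) * Real.exp (-(k * u)))) ∂μ
        + ENNReal.ofReal m * (ENNReal.ofReal ζ * ∫⁻ x, negLog x ∂μ)) := by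
  have hT := measurable_rpow_const ζ
  have hae : ∀ᵐ x ∂μ, x ∈ Icc (0 : ℝ) 1 := hμ
  have hm2 : Measurable fun q : ℝ × ℝ => negLog |q.1 ^ ν - q.2 ^ ν| + negLog |q.1 - q.2| := by
    fun_prop
  have hm3 : Measurable fun q : ℝ × ℝ => negLog (1 - q.1 ^ σ * Real.exp (-(k * q.2))) := by
    fun_prop
  rw [fieldEnergy, lintegral_modelField, lintegral_map hm2.lintegral_prod_right' hT,
    lintegral_map hm3.lintegral_prod_right' hT, lintegral_map measurable_negLog hT,
    ← lintegral_const_mul' (ENNReal.ofReal ζ) _ ENNReal.ofReal_ne_top]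
  congr 2
  · refine lintegral_congr_ae ?_
    filter_upwards [hae] with x hx
    rw [lintegral_map (by fun_prop) hT]
    refine lintegral_congr_ae ?_
    filter_upwards [hae] with y hy
    rw [Real.rpow_mul hx.1, Real.rpow_mul hy.1]
  · congr 1
    refine lintegral_congr_ae ?_
    filter_upwards [hae] with x hx
    rw [Real.rpow_mul hx.1]
  · congr 1
    refine lintegral_congr_ae ?_
    filter_upwards [hae] with x hx using negLog_rpow hx.1 hζ

/-! ### Transfer of minimizers under power maps -/

lemma IsUniqueMinimizer.congr {C : Set (Measure ℝ)} {F G : Measure ℝ → ℝ≥0∞} {μ : Measure ℝ}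
    (hμ : IsUniqueMinimizer C F μ) (hFG : ∀ μ ∈ C, G μ = F μ) : IsUniqueMinimizer C G μ :=
  ⟨hμ.1, fun μ' hμ' hne => by
    rw [hFG μ hμ.1, hFG μ' hμ']
    exact hμ.2 μ' hμ' hne⟩

lemma IsUniqueMinimizer.map_rpow {b h ζ c : ℝ} (hζ : 0 < ζ) (hh : 0 ≤ h) (hc : 0 < c)
    {F G : Measure ℝ → ℝ≥0∞} {ω : Measure ℝ}
    (hω : IsUniqueMinimizer (constrainedMeasures (b * ζ) (h ^ ζ)) G ω)
    (hFG : ∀ μ ∈ constrainedMeasures b h, F μ = ENNReal.ofReal c * G (μ.map fun x => x ^ ζ)) :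
    IsUniqueMinimizer (constrainedMeasures b h) F (ω.map fun y => y ^ (1 / ζ)) := by
  have hmem : ω.map (fun y => y ^ (1 / ζ)) ∈ constrainedMeasures b h := by
    have := map_rpow_mem_constrainedMeasures (Real.rpow_nonneg hh ζ) (one_div_pos.2 hζ) hω.1
    rwa [rpow_rpow_one_div hh hζ, mul_assoc, mul_one_div_cancel hζ.ne', mul_one] at this
  have hinv : (ω.map fun y => y ^ (1 / ζ)).map (fun x => x ^ ζ) = ω := by
    have := map_rpow_map_rpow_one_div (one_div_pos.2 hζ) hω.1.2.1
    rwa [one_div_one_div] at this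
  refine ⟨hmem, fun μ hμ hne => ?_⟩
  rw [hFG _ hmem, hFG _ hμ, hinv]
  refine ENNReal.mul_lt_mul_right (by simpa using hc) ENNReal.ofReal_ne_top ?_
  refine hω.2 _ (map_rpow_mem_constrainedMeasures hh hζ hμ) fun heq => hne ?_
  rw [← map_rpow_map_rpow_one_div hζ hμ.2.1, heq]

/-- The common core of the six cases, with `D = γ² - κ`, and `σ = ν` or `σ = 1` for the first or
second model problem. The coefficients in `hR` are `κ²` times those of the model functional, up to
the factor `ζ` coming from `ln (x ^ ζ) = ζ ln x`. -/
lemma exists_minimizers_map_rpow {β ζ ν σ κ m n₁ n₂ k D : ℝ} (hβ : 0 ≤ β) (hζ : 0 < ζ)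
    (hν : 0 < ν) (hσ : 0 < σ) (hκ : 0 < κ) (hm : 0 ≤ m) (hk : 0 ≤ k) (hD : 0 ≤ D)
    (hn : k * n₁ = -(β * (σ * ζ * D))) {R : Measure ℝ → ℝ≥0∞}
    (hR : ∀ μ, R μ = ENNReal.ofReal (κ ^ 2 / 2) *
        ∫⁻ x, ∫⁻ y, (negLog |x ^ (ζ * ν) - y ^ (ζ * ν)| + negLog |x ^ ζ - y ^ ζ|) ∂μ ∂μ
      + ENNReal.ofReal κ *
          ∫⁻ x, (∫⁻ u in Ioc n₁ n₂, negLog (1 - x ^ (ζ * σ) * Real.exp (-(k * u)))) ∂μ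
      + ENNReal.ofReal (κ ^ 2 * m * ζ) * ∫⁻ x, negLog x ∂μ) :
    ∃ ω, IsUniqueMinimizer (constrainedMeasures (β * ζ * κ) (Real.exp (-(ζ * β * D))))
        (fieldEnergy ν (modelField σ (1 / κ) n₁ n₂ k m)) ω ∧
      IsUniqueMinimizer (constrainedMeasures (β * κ) (Real.exp (-(β * D)))) R
        (ω.map fun y => y ^ (1 / ζ)) ∧
      IsPowerPushforward ζ ω (ω.map fun y => y ^ (1 / ζ)) := by
  have hexp : Real.exp (-(ζ * β * D)) = Real.exp (-(β * D)) ^ ζ := by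
    rw [← Real.exp_mul]
    congr 1
    ring
  have hh1 : Real.exp (-(β * D)) ≤ 1 := Real.exp_le_one_iff.2 (by nlinarith)
  have hh1' : Real.exp (-(ζ * β * D)) ≤ 1 := by
    rw [hexp]
    exact Real.rpow_le_one (Real.exp_pos _).le hh1 hζ.le
  obtain ⟨ω, hω⟩ := exists_isUniqueMinimizer (b := β * ζ * κ) hν (Real.exp_pos (-(ζ * β * D))) hh1'
    (lowerSemicontinuous_modelField hσ (1 / κ) n₁ n₂ k m) fun a ha =>
      -- The end point condition `hn` makes `h ^ σ e ^ (-k n₁)` exactly `1`.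
      modelField_bounded hσ hk (Real.exp_pos _) (by
        rw [← Real.exp_mul, ← Real.exp_add, hn, Real.exp_le_one_iff]
        exact le_of_eq (by ring)) ha
  have : IsProbabilityMeasure ω := hω.1.1
  refine ⟨ω, hω, ?_, isPowerPushforward_map hζ hω.1.2.1⟩
  rw [hexp, mul_right_comm] at hω
  refine hω.map_rpow hζ (Real.exp_pos _).le (pow_pos hκ 2) fun μ hμ => ?_
  have : IsProbabilityMeasure μ := hμ.1
  have hκ2 : 0 ≤ κ ^ 2 := sq_nonneg κ
  rw [hR, fieldEnergy_map_rpow hζ _ _ _ _ _ (compl_Icc_zero_one_null hh1 hμ.2.1), mul_add,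
    mul_add, ← mul_assoc, ← mul_assoc, ← mul_assoc, ← mul_assoc, ← ENNReal.ofReal_mul hκ2,
    ← ENNReal.ofReal_mul hκ2, ← ENNReal.ofReal_mul hκ2, ← ENNReal.ofReal_mul (by positivity),
    add_assoc]
  congr 4
  · ring
  · field_simp

/-! ### The model functionals as field energies -/

namespace ModelParameters

lemma setLIntegral_eq_of_compl_null {s : Set ℝ} {ω : Measure ℝ} (hω : ω sᶜ = 0) (f : ℝ → ℝ≥0∞) :
    ∫⁻ x in s, f x ∂ω = ∫⁻ x, f x ∂ω := by
  rw [Measure.restrict_eq_self_of_ae_mem (show ∀ᵐ x ∂ω, x ∈ s from hω)]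

lemma firstFunctional_eq (p : ModelParameters) (β : ℝ) {ω : Measure ℝ}
    (hω : ω (Icc 0 1)ᶜ = 0) : p.firstFunctional β ω =
      fieldEnergy p.ν (modelField p.ν (1 / p.κ) p.n₁ p.n₂ (β * p.α) p.m₁) ω := by
  simp only [firstFunctional, fieldEnergy, lintegral_modelField, setLIntegral_eq_of_compl_null hω,
    add_assoc]

lemma secondFunctional_eq (p : ModelParameters) (β : ℝ) {ω : Measure ℝ}
    (hω : ω (Icc 0 1)ᶜ = 0) : p.secondFunctional β ω =
      fieldEnergy p.ν (modelField 1 (1 / p.κ) p.n₁ p.n₂ (β * p.α) p.m₁) ω := by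
  simp only [secondFunctional, fieldEnergy, lintegral_modelField,
    setLIntegral_eq_of_compl_null hω, add_assoc, Real.rpow_one]

/-- Since `κ ≤ γ²`, the right end point is at most `1`, so restricting the integrals to `[0, 1]`
changes nothing. -/
lemma compl_Icc_null_of_mem_competitors {p : ModelParameters} {γ β : ℝ} (hβ : 0 ≤ β)
    (hρ : 0 < p.ρ) (hκ : p.κ ≤ γ ^ 2) {ω : Measure ℝ} (hω : ω ∈ p.competitors γ β) :
    ω (Icc 0 1)ᶜ = 0 := by
  refine compl_Icc_zero_one_null (Real.exp_le_one_iff.2 ?_) hω.2.1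
  have := mul_nonneg (mul_nonneg hρ.le hβ) (sub_nonneg.2 hκ)
  linarith

end ModelParameters

lemma recoveredFromFirst {γ η θ β ξ : ℝ} (hβ : 0 ≤ β) {p : ModelParameters}
    (hp : p.FirstAdmissible γ) (hκ : kappa γ ξ = p.κ) (hκγ : p.κ ≤ γ ^ 2)
    (hR : ∀ μ, rateFunction γ η θ β ξ μ = ENNReal.ofReal (p.κ ^ 2 / 2) *
        ∫⁻ x, ∫⁻ y, (negLog |x ^ (p.ρ * p.ν) - y ^ (p.ρ * p.ν)|
          + negLog |x ^ p.ρ - y ^ p.ρ|) ∂μ ∂μ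
      + ENNReal.ofReal p.κ * ∫⁻ x, (∫⁻ u in Ioc p.n₁ p.n₂,
          negLog (1 - x ^ (p.ρ * p.ν) * Real.exp (-(β * p.α * u)))) ∂μ
      + ENNReal.ofReal (p.κ ^ 2 * p.m₁ * p.ρ) * ∫⁻ x, negLog x ∂μ) :
    RecoveredFromFirst γ η θ β ξ p.ρ p := by
  obtain ⟨⟨hν, hκ0, hα, hρ, hm, hn⟩, hend⟩ := id hp
  obtain ⟨ω, hω, hμ, hpush⟩ := exists_minimizers_map_rpow hβ hρ (one_pos.trans hν)
    (one_pos.trans hν) hκ0 hm (mul_nonneg hβ hα.le) (sub_nonneg.2 hκγ)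
    (by linear_combination β * hend) hR
  refine ⟨hp, ω, _, hω.congr fun ω' hω' => p.firstFunctional_eq β
    (ModelParameters.compl_Icc_null_of_mem_competitors hβ hρ hκγ hω'), ?_, hpush⟩
  rw [IsEquilibriumMeasure, sliceMeasures, hκ]
  exact hμ

lemma recoveredFromSecond {γ η θ β ξ : ℝ} (hβ : 0 ≤ β) {p : ModelParameters}
    (hp : p.SecondAdmissible γ) (hκ : kappa γ ξ = p.κ) (hκγ : p.κ ≤ γ ^ 2)
    (hR : ∀ μ, rateFunction γ η θ β ξ μ = ENNReal.ofReal (p.κ ^ 2 / 2) *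
        ∫⁻ x, ∫⁻ y, (negLog |x ^ (p.ρ * p.ν) - y ^ (p.ρ * p.ν)|
          + negLog |x ^ p.ρ - y ^ p.ρ|) ∂μ ∂μ
      + ENNReal.ofReal p.κ * ∫⁻ x, (∫⁻ u in Ioc p.n₁ p.n₂,
          negLog (1 - x ^ p.ρ * Real.exp (-(β * p.α * u)))) ∂μ
      + ENNReal.ofReal (p.κ ^ 2 * p.m₁ * p.ρ) * ∫⁻ x, negLog x ∂μ) :
    RecoveredFromSecond γ η θ β ξ p.ρ p := by
  obtain ⟨⟨hν, hκ0, hα, hρ, hm, hn⟩, hend⟩ := id hp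
  obtain ⟨ω, hω, hμ, hpush⟩ := exists_minimizers_map_rpow (n₁ := p.n₁) (n₂ := p.n₂) (σ := 1)
    (R := rateFunction γ η θ β ξ) hβ hρ (one_pos.trans hν) one_pos hκ0 hm (mul_nonneg hβ hα.le) (sub_nonneg.2 hκγ)
    (by linear_combination β * hend) (by simpa only [mul_one] using hR)
  refine ⟨hp, ω, _, hω.congr fun ω' hω' => p.secondFunctional_eq β
    (ModelParameters.compl_Icc_null_of_mem_competitors hβ hρ hκγ hω'), ?_, hpush⟩
  rw [IsEquilibriumMeasure, sliceMeasures, hκ]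
  exact hμ

/-! ### The rate function in the three ranges of times -/

/-- For `ξ ≤ 0` the rate function has `e ^ (βθu)` where the model problems have a negative exponent.
The reflection swaps the closed end of the interval, which only matters on a null set. -/
lemma setLIntegral_Ioc_comp_neg (a b : ℝ) (f : ℝ → ℝ≥0∞) :
    ∫⁻ u in Ioc a b, f u = ∫⁻ u in Ioc (-b) (-a), f (-u) := by
  rw [← (Measure.measurePreserving_neg (volume : Measure ℝ)).setLIntegral_comp_preimage_emb
    (Homeomorph.neg ℝ).measurableEmbedding f (Ioc a b)]
  simp only [neg_preimage, neg_Ioc]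
  exact setLIntegral_congr Ico_ae_eq_Ioc

lemma kappa_of_nonpos {γ ξ : ℝ} (hξ : ξ ≤ 0) : kappa γ ξ = γ ^ 2 - |ξ| := if_pos hξ

lemma kappa_of_pos_of_le {γ ξ : ℝ} (hξ : 0 < ξ) (hξ1 : ξ ≤ 1 - γ ^ 2) : kappa γ ξ = γ ^ 2 := by
  rw [kappa, if_neg hξ.not_ge, if_pos hξ1]

lemma kappa_of_pos_of_lt {γ ξ : ℝ} (hξ : 0 < ξ) (hξ1 : 1 - γ ^ 2 < ξ) : kappa γ ξ = 1 - ξ := by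
  rw [kappa, if_neg hξ.not_ge, if_neg hξ1.not_ge]

lemma rateFunction_of_nonpos {γ η θ β ξ : ℝ} (hξ : ξ ≤ 0) (μ : Measure ℝ) :
    rateFunction γ η θ β ξ μ = ENNReal.ofReal ((γ ^ 2 - |ξ|) ^ 2 / 2) *
        ∫⁻ x, ∫⁻ y, (negLog |x ^ θ - y ^ θ| + negLog |x ^ η - y ^ η|) ∂μ ∂μ
      + ENNReal.ofReal (γ ^ 2 - |ξ|) * ∫⁻ x, (∫⁻ u in Ioc (-|ξ|) (1 - γ ^ 2),
          negLog (1 - x ^ θ * Real.exp (-(β * θ * u)))) ∂μ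
      + ENNReal.ofReal ((γ ^ 2 - |ξ|) * (η * |ξ|)) * ∫⁻ x, negLog x ∂μ := by
  simp only [rateFunction, interactionEnergy, pochhammerEnergy, logEnergy, kappa_of_nonpos hξ,
    if_pos hξ, setLIntegral_Ioc_comp_neg (γ ^ 2 - 1) |ξ|, neg_sub, mul_neg]

lemma rateFunction_of_pos_of_le {γ η θ β ξ : ℝ} (hξ : 0 < ξ) (hξ1 : ξ ≤ 1 - γ ^ 2)
    (μ : Measure ℝ) :
    rateFunction γ η θ β ξ μ = ENNReal.ofReal ((γ ^ 2) ^ 2 / 2) *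
        ∫⁻ x, ∫⁻ y, (negLog |x ^ θ - y ^ θ| + negLog |x ^ η - y ^ η|) ∂μ ∂μ
      + ENNReal.ofReal (γ ^ 2) * ∫⁻ x, (∫⁻ u in Ioc 0 (1 - γ ^ 2 - ξ),
          negLog (1 - x ^ θ * Real.exp (-(β * θ * u)))) ∂μ
      + ENNReal.ofReal (γ ^ 2 * (θ * ξ)) * ∫⁻ x, negLog x ∂μ := by
  simp only [rateFunction, interactionEnergy, pochhammerEnergy, logEnergy,
    kappa_of_pos_of_le hξ hξ1, if_neg hξ.not_ge, if_pos hξ1]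

lemma rateFunction_of_pos_of_lt {γ η θ β ξ : ℝ} (hξ : 0 < ξ) (hξ1 : 1 - γ ^ 2 < ξ)
    (μ : Measure ℝ) :
    rateFunction γ η θ β ξ μ = ENNReal.ofReal ((1 - ξ) ^ 2 / 2) *
        ∫⁻ x, ∫⁻ y, (negLog |x ^ θ - y ^ θ| + negLog |x ^ η - y ^ η|) ∂μ ∂μ
      + ENNReal.ofReal (1 - ξ) * ∫⁻ x, (∫⁻ u in Ioc (1 - γ ^ 2 - ξ) 0,
          negLog (1 - x ^ η * Real.exp (-(β * η * u)))) ∂μ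
      + ENNReal.ofReal ((1 - ξ) * (θ * ξ)) * ∫⁻ x, negLog x ∂μ := by
  simp only [rateFunction, interactionEnergy, pochhammerEnergy, logEnergy,
    kappa_of_pos_of_lt hξ hξ1, if_neg hξ.not_ge, if_neg hξ1.not_ge]

end MuttalibBorodin

/-! ### The six cases: admissibility and matching of coefficients -/

theorem corollary1p3 (γ η θ β : ℝ) (hγ : 0 < γ) (hγ1 : γ ≤ 1) (hη : 0 < η) (hθ : 0 < θ)
    (hβ : 0 ≤ β) (ξ : ℝ) :
    (η < θ →
      (ξ ∈ Set.Ioc (-γ ^ 2) 0 →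
        MuttalibBorodin.RecoveredFromFirst γ η θ β ξ η
          { ν := θ / η, κ := γ ^ 2 - |ξ|, m₁ := |ξ| / (γ ^ 2 - |ξ|),
            n₁ := -|ξ|, n₂ := 1 - γ ^ 2, α := θ, ρ := η }) ∧
      (ξ ∈ Set.Ioc 0 (1 - γ ^ 2) →
        MuttalibBorodin.RecoveredFromFirst γ η θ β ξ η
          { ν := θ / η, κ := γ ^ 2, m₁ := θ * ξ / (η * γ ^ 2),
            n₁ := 0, n₂ := 1 - γ ^ 2 - ξ, α := θ, ρ := η }) ∧
      (ξ ∈ Set.Ioo (1 - γ ^ 2) 1 →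
        MuttalibBorodin.RecoveredFromSecond γ η θ β ξ η
          { ν := θ / η, κ := 1 - ξ, m₁ := θ * ξ / (η * (1 - ξ)),
            n₁ := 1 - γ ^ 2 - ξ, n₂ := 0, α := η, ρ := η })) ∧
    (θ < η →
      (ξ ∈ Set.Ioc (-γ ^ 2) 0 →
        MuttalibBorodin.RecoveredFromSecond γ η θ β ξ θ
          { ν := η / θ, κ := γ ^ 2 - |ξ|, m₁ := |ξ| * η / ((γ ^ 2 - |ξ|) * θ),
            n₁ := -|ξ|, n₂ := 1 - γ ^ 2, α := θ, ρ := θ }) ∧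
      (ξ ∈ Set.Ioc 0 (1 - γ ^ 2) →
        MuttalibBorodin.RecoveredFromSecond γ η θ β ξ θ
          { ν := η / θ, κ := γ ^ 2, m₁ := ξ / γ ^ 2,
            n₁ := 0, n₂ := 1 - γ ^ 2 - ξ, α := θ, ρ := θ }) ∧
      (ξ ∈ Set.Ioo (1 - γ ^ 2) 1 →
        MuttalibBorodin.RecoveredFromFirst γ η θ β ξ θ
          { ν := η / θ, κ := 1 - ξ, m₁ := ξ / (1 - ξ),
            n₁ := 1 - γ ^ 2 - ξ, n₂ := 0, α := η, ρ := θ })) := by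
  have hγ2 : 0 < γ ^ 2 := pow_pos hγ 2
  have hγ21 : γ ^ 2 ≤ 1 := pow_le_one₀ hγ.le hγ1
  have hνη : η < θ → 1 < θ / η := (one_lt_div hη).2
  have hνθ : θ < η → 1 < η / θ := (one_lt_div hθ).2
  have hmulη : η * (θ / η) = θ := mul_div_cancel₀ θ hη.ne'
  have hmulθ : θ * (η / θ) = η := mul_div_cancel₀ η hθ.ne'
  refine ⟨fun hlt => ⟨fun hξ => ?_, fun hξ => ?_, fun hξ => ?_⟩,
    fun hlt => ⟨fun hξ => ?_, fun hξ => ?_, fun hξ => ?_⟩⟩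
  · have habs : |ξ| = -ξ := abs_of_nonpos hξ.2
    have hκ : 0 < γ ^ 2 - |ξ| := by linarith [hξ.1]
    refine MuttalibBorodin.recoveredFromFirst hβ ⟨⟨hνη hlt, hκ, hθ, hη, by positivity, ?_⟩, ?_⟩
      (MuttalibBorodin.kappa_of_nonpos hξ.2) (sub_le_self _ (abs_nonneg ξ)) fun μ => ?_
    · linarith [abs_nonneg ξ]
    · simp only
      field_simp
      ring
    · rw [MuttalibBorodin.rateFunction_of_nonpos hξ.2]
      simp only [hmulη]
      congr 3
      field_simp
  · refine MuttalibBorodin.recoveredFromFirst hβ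
      ⟨⟨hνη hlt, hγ2, hθ, hη, ?_, by linarith [hξ.2]⟩, ?_⟩
      (MuttalibBorodin.kappa_of_pos_of_le hξ.1 hξ.2) le_rfl fun μ => ?_
    · have := hξ.1
      positivity
    · simp
    · rw [MuttalibBorodin.rateFunction_of_pos_of_le hξ.1 hξ.2]
      simp only [hmulη]
      congr 3
      field_simp
  -- Positivity of `ξ` follows from `γ² ≤ 1`.
  · have hξ0 : 0 < ξ := by linarith [hξ.1]
    have hκ : 0 < 1 - ξ := by linarith [hξ.2]
    refine MuttalibBorodin.recoveredFromSecond hβ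
      ⟨⟨hνη hlt, hκ, hη, hη, by positivity, by linarith [hξ.1]⟩, ?_⟩
      (MuttalibBorodin.kappa_of_pos_of_lt hξ0 hξ.1) (by linarith [hξ.1]) fun μ => ?_
    · simp only
      ring
    · rw [MuttalibBorodin.rateFunction_of_pos_of_lt hξ0 hξ.1]
      simp only [hmulη]
      congr 3
      field_simp
  · have habs : |ξ| = -ξ := abs_of_nonpos hξ.2
    have hκ : 0 < γ ^ 2 - |ξ| := by linarith [hξ.1]
    refine MuttalibBorodin.recoveredFromSecond hβ ⟨⟨hνθ hlt, hκ, hθ, hθ, by positivity, ?_⟩, ?_⟩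
      (MuttalibBorodin.kappa_of_nonpos hξ.2) (sub_le_self _ (abs_nonneg ξ)) fun μ => ?_
    · linarith [abs_nonneg ξ]
    · simp only
      ring
    · rw [MuttalibBorodin.rateFunction_of_nonpos hξ.2]
      -- Now `ζ = θ` and `ζ ν = η`, so the two interactions occur in the opposite order to that of
      -- the model problem.
      simp only [hmulθ, add_comm (MuttalibBorodin.negLog |_ ^ η - _|)]
      congr 3
      field_simp
  · refine MuttalibBorodin.recoveredFromSecond hβ
      ⟨⟨hνθ hlt, hγ2, hθ, hθ, ?_, by linarith [hξ.2]⟩, ?_⟩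
      (MuttalibBorodin.kappa_of_pos_of_le hξ.1 hξ.2) le_rfl fun μ => ?_
    · have := hξ.1
      positivity
    · simp
    · rw [MuttalibBorodin.rateFunction_of_pos_of_le hξ.1 hξ.2]
      simp only [hmulθ, add_comm (MuttalibBorodin.negLog |_ ^ η - _|)]
      congr 3
      field_simp
  · have hξ0 : 0 < ξ := by linarith [hξ.1]
    have hκ : 0 < 1 - ξ := by linarith [hξ.2]
    refine MuttalibBorodin.recoveredFromFirst hβ
      ⟨⟨hνθ hlt, hκ, hη, hθ, by positivity, by linarith [hξ.1]⟩, ?_⟩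
      (MuttalibBorodin.kappa_of_pos_of_lt hξ0 hξ.1) (by linarith [hξ.1]) fun μ => ?_
    · simp only
      field_simp
      ring
    · rw [MuttalibBorodin.rateFunction_of_pos_of_lt hξ0 hξ.1]
      simp only [hmulθ, add_comm (MuttalibBorodin.negLog |_ ^ η - _|)]
      congr 3
      field_simp
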